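/- Consider $n$ participants $1,\dots,n$. An access structure is an upward closed family of accepted coalitions (subsets of $\{1,\dots,n\}$); all other coalitions are forbidden. A secret sharing scheme for it is a tuple of jointly distributed random variables $(S_0,S_1,\dots,S_n)$ with finite ranges and $H(S_0)>0$, where $H$ is Shannon entropy, such that for every coalition $J$, with $S_J=(S_j)_{j\in J}$, one has $H(S_0\mid S_J)=0$ if $J$ is accepted and $H(S_0\mid S_J)=H(S_0)$ if $J$ is forbidden. The information ratio of the scheme is $\max_{1\le i\le n} H(S_i)/H(S_0)$, and the information ratio of an access structure is the infimum of the information ratios of all secret sharing schemes for it. **Theorem.** Consider the seven access structures on the participants $1,\dots,7$ with the following minimal accepted coalitions (where, for instance, $123$ stands for $\{1,2,3\}$): - $\mathcal{A}$: $123,145,167,246,257,347,356,1247$; - $\mathcal{A}^*$: $123,145,167,246,257,347,1356,2356,3456,3567$; - $\mathcal{F}$: $123,145,167,246,257,347,356,1247,1256$; - $\mathcal{F}^*$: $123,145,167,246,257,1347,1356,2347,2356,3456,3457,3467,3567$; - $\widehat{\mathcal{F}}$: $123,145,167,246,257,347,1256,1356,2356,3456,3567$; - $\mathcal{Q}$: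 $123,145,167,246,257,347,1247,1256,1356,2356,3456,3567$; - $\mathcal{Q}^*$: $123,145,167,246,257,1247,1347,1356,2347,2356,3456,3457,3467,3567$. The information ratios of $\mathcal{A}$, $\mathcal{A}^*$, $\mathcal{F}$, $\mathcal{F}^*$, $\widehat{\mathcal{F}}$, $\mathcal{Q}$ and $\mathcal{Q}^*$ are at least $57/50$, $52/45$, $17/15$, $8/7$, $23/20$, $17/15$ and $8/7$, respectively. -/

import Mathlib

namespace SecretSharing

noncomputable section

/-- An access structure for `n` participants. The participants are the nonzero elements of
`Fin (n + 1)`, labelled `1, …, n`; the index `0` is reserved for the secret. A coalition is a set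
of participants, that is, a finset not containing `0`. The accepted coalitions form an upward closed
family; every other coalition is forbidden. -/
structure AccessStructure (n : ℕ) where
  accepted : Set (Finset (Fin (n + 1)))
  zero_notMem : ∀ J ∈ accepted, (0 : Fin (n + 1)) ∉ J
  mono : ∀ J ∈ accepted, ∀ K : Finset (Fin (n + 1)), J ⊆ K → (0 : Fin (n + 1)) ∉ K → K ∈ accepted

/-- A coalition is forbidden when it is not accepted. -/
def AccessStructure.forbidden {n : ℕ} (A : AccessStructure n) : Set (Finset (Fin (n + 1))) :=
  {J | (0 : Fin (n + 1)) ∉ J ∧ J ∉ A.accepted}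

/-- The access structure in which a coalition is accepted iff it contains a member of `M`. -/
def AccessStructure.generatedBy {n : ℕ} (M : Finset (Finset (Fin (n + 1)))) :
    AccessStructure n where
  accepted := {J | (0 : Fin (n + 1)) ∉ J ∧ ∃ B ∈ M, B ⊆ J}
  zero_notMem := fun _ hJ => hJ.1
  mono := fun _ hJ _ hJK hK =>
    ⟨hK, hJ.2.imp fun _ hB => ⟨hB.1, hB.2.trans hJK⟩⟩

/-- The Shannon entropy (in nats) of a distribution on a finite set. -/
def entropy {α : Type} [Fintype α] (p : PMF α) : ℝ :=
  ∑ a, Real.negMulLog (p a).toReal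

/-- For jointly distributed random variables `(S_i)` with finite ranges, given by their joint
distribution `law`, the Shannon entropy `H(S_J)` of the sub-tuple `S_J = (S_j)_{j ∈ J}`. -/
def jointEntropy {n : ℕ} {S : Fin (n + 1) → Type} [∀ i, Fintype (S i)]
    (law : PMF (∀ i, S i)) (J : Finset (Fin (n + 1))) : ℝ :=
  entropy (law.map fun x (j : J) => x j)

/-- The conditional entropy `H(S_I | S_J) = H(S_I, S_J) - H(S_J)`. -/
def condEntropy {n : ℕ} {S : Fin (n + 1) → Type} [∀ i, Fintype (S i)]
    (law : PMF (∀ i, S i)) (I J : Finset (Fin (n + 1))) : ℝ :=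
  jointEntropy law (I ∪ J) - jointEntropy law J

/-- A (perfect) secret sharing scheme for the access structure `A`: a joint distribution of a secret
`S_0` and shares `S_1, …, S_n`, with finite ranges and a nontrivial secret, such that every accepted
coalition determines the secret and every forbidden coalition has no information about it. -/
structure Scheme {n : ℕ} (A : AccessStructure n) where
  S : Fin (n + 1) → Type
  fintype : ∀ i, Fintype (S i)
  law : PMF (∀ i, S i)
  secret_pos : 0 < jointEntropy law {0}
  correct : ∀ J ∈ A.accepted, condEntropy law {0} J = 0
  secure : ∀ J ∈ A.forbidden, condEntropy law {0} J = jointEntropy law {0}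

attribute [instance] Scheme.fintype

/-- The information ratio `max_{1 ≤ i ≤ n} H(S_i) / H(S_0)` of a scheme. -/
def Scheme.informationRatio {n : ℕ} {A : AccessStructure n} (σ : Scheme A) : ℝ :=
  ⨆ i : Fin n, jointEntropy σ.law {i.succ} / jointEntropy σ.law {0}

/-- The information ratio of an access structure: the infimum, taken in the extended reals, of the
information ratios of all secret sharing schemes for it. -/
def AccessStructure.informationRatio {n : ℕ} (A : AccessStructure n) : EReal :=
  ⨅ σ : Scheme A, (σ.informationRatio : EReal)

/-! The seven access structures on the participants `1, …, 7`, by their minimal accepted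
coalitions. -/

/-- The access structure `𝒜`. -/
def accessA : AccessStructure 7 := .generatedBy
  {{1, 2, 3}, {1, 4, 5}, {1, 6, 7}, {2, 4, 6}, {2, 5, 7}, {3, 4, 7}, {3, 5, 6}, {1, 2, 4, 7}}

/-- The access structure `𝒜*`. -/
def accessAStar : AccessStructure 7 := .generatedBy
  {{1, 2, 3}, {1, 4, 5}, {1, 6, 7}, {2, 4, 6}, {2, 5, 7}, {3, 4, 7},
    {1, 3, 5, 6}, {2, 3, 5, 6}, {3, 4, 5, 6}, {3, 5, 6, 7}}

/-- The access structure `ℱ`. -/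
def accessF : AccessStructure 7 := .generatedBy
  {{1, 2, 3}, {1, 4, 5}, {1, 6, 7}, {2, 4, 6}, {2, 5, 7}, {3, 4, 7}, {3, 5, 6},
    {1, 2, 4, 7}, {1, 2, 5, 6}}

/-- The access structure `ℱ*`. -/
def accessFStar : AccessStructure 7 := .generatedBy
  {{1, 2, 3}, {1, 4, 5}, {1, 6, 7}, {2, 4, 6}, {2, 5, 7},
    {1, 3, 4, 7}, {1, 3, 5, 6}, {2, 3, 4, 7}, {2, 3, 5, 6},
    {3, 4, 5, 6}, {3, 4, 5, 7}, {3, 4, 6, 7}, {3, 5, 6, 7}}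

/-- The access structure `ℱ̂`. -/
def accessFHat : AccessStructure 7 := .generatedBy
  {{1, 2, 3}, {1, 4, 5}, {1, 6, 7}, {2, 4, 6}, {2, 5, 7}, {3, 4, 7},
    {1, 2, 5, 6}, {1, 3, 5, 6}, {2, 3, 5, 6}, {3, 4, 5, 6}, {3, 5, 6, 7}}

/-- The access structure `𝒬`. -/
def accessQ : AccessStructure 7 := .generatedBy
  {{1, 2, 3}, {1, 4, 5}, {1, 6, 7}, {2, 4, 6}, {2, 5, 7}, {3, 4, 7},
    {1, 2, 4, 7}, {1, 2, 5, 6}, {1, 3, 5, 6}, {2, 3, 5, 6}, {3, 4, 5, 6}, {3, 5, 6, 7}}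

/-- The access structure `𝒬*`. -/
def accessQStar : AccessStructure 7 := .generatedBy
  {{1, 2, 3}, {1, 4, 5}, {1, 6, 7}, {2, 4, 6}, {2, 5, 7},
    {1, 2, 4, 7}, {1, 3, 4, 7}, {1, 3, 5, 6}, {2, 3, 4, 7}, {2, 3, 5, 6},
    {3, 4, 5, 6}, {3, 4, 5, 7}, {3, 4, 6, 7}, {3, 5, 6, 7}}

end

end SecretSharing

/-! Each bound is an explicit linear-programming certificate. In any scheme the entropies of
sub-tuples satisfy `I(x ; y | z) ≥ 0`, and perfect sharing fixes how the secret enters: adding it to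
a set of shares raises the entropy by `0` or by `H(S_0)`. Further linear constraints come from the
copy lemma: the variables may be extended by a copy of some of them (possibly merged) that has the
same joint law with a chosen set `C` of variables and is independent of the rest given `C`. The
original entropies do not change, so an inequality between them that is derived in the extended
system holds for the scheme.

In each certificate one step copies the secret, alone or merged with a share, over a forbidden
coalition; every other step copies over a set that contains the secret. A nonnegative combination of
conditional mutual informations then reduces, by the copy and secrecy equations, to `∑ wᵢ H(Sᵢ) -
total * H(S_0)`. Since every `H(Sᵢ)` is at most the information ratio times `H(S_0)`, the ratio is
at least `total / ∑ wᵢ`.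

Random variables are treated as partitions of a finite probability space, so that joining variables
is an infimum of setoids. `IsDistribution.partitionEntropy_submodular` gives the inequalities,
`IsEntropic.exists_copies` the copies, `Scheme.sharesSecret` the secrecy equations, and
`Certificate.le_informationRatio` combines them. What remains for each structure is to verify that
one integral linear form vanishes, which `LinForm.isZero` turns into a comparison of two large
natural numbers. -/

namespace SecretSharing

/-! ### Entropy of a partition of a finite probability space -/

open Classical in
/-- The mass of the class of `ω` under the equivalence relation `r`. -/
noncomputable def classMass {Ω : Type} [Fintype Ω] (p : Ω → ℝ) (r : Setoid Ω) (ω : Ω) : ℝ :=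
  ∑ η, if r ω η then p η else 0

/-- The Shannon entropy of the partition into the classes of `r`. -/
noncomputable def partitionEntropy {Ω : Type} [Fintype Ω] (p : Ω → ℝ) (r : Setoid Ω) : ℝ :=
  -∑ ω, p ω * Real.log (classMass p r ω)

/-- `p` is a probability distribution on the finite type `Ω`. -/
structure IsDistribution {Ω : Type} [Fintype Ω] (p : Ω → ℝ) : Prop where
  nonneg : ∀ ω, 0 ≤ p ω
  sum_eq_one : ∑ ω, p ω = 1

section

variable {Ω : Type} [Fintype Ω] {p : Ω → ℝ}

theorem IsDistribution.classMass_nonneg (hp : IsDistribution p) (r : Setoid Ω) (ω : Ω) :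
    0 ≤ classMass p r ω := by
  classical
  exact Finset.sum_nonneg fun η _ => by split_ifs <;> simp [hp.nonneg]

theorem IsDistribution.le_classMass (hp : IsDistribution p) (r : Setoid Ω) (ω : Ω) :
    p ω ≤ classMass p r ω := by
  classical
  have h := Finset.single_le_sum (f := fun η => if r ω η then p η else 0)
    (fun η _ => by split_ifs <;> simp [hp.nonneg]) (Finset.mem_univ ω)
  have hr : r ω ω := r.refl' ω
  simpa [hr, classMass] using h

theorem IsDistribution.classMass_pos (hp : IsDistribution p) (r : Setoid Ω) {ω : Ω}
    (hω : p ω ≠ 0) : 0 < classMass p r ω :=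
  lt_of_lt_of_le (lt_of_le_of_ne (hp.nonneg ω) hω.symm) (hp.le_classMass r ω)

theorem classMass_congr (r : Setoid Ω) {ω η : Ω} (h : r ω η) :
    classMass p r ω = classMass p r η := by
  classical
  refine Finset.sum_congr rfl fun ζ _ => ?_
  have : r ω ζ ↔ r η ζ := ⟨fun h' => r.trans' (r.symm' h) h', fun h' => r.trans' h h'⟩
  simp [this]

/-- The inner estimate for submodularity: given `η` and `ζ`, the points `ω` with `r ω η` and
`s ω ζ` form at most one class of `r ⊓ s`. -/
theorem IsDistribution.sum_inter_le (hp : IsDistribution p) {r s t : Setoid Ω} (hr : r ≤ t)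
    (hs : s ≤ t) (η ζ : Ω) [∀ ω, Decidable (r ω η ∧ s ω ζ)] [Decidable (t η ζ)] :
    (∑ ω, if r ω η ∧ s ω ζ then p ω / (classMass p (r ⊓ s) ω * classMass p t ω) else 0) ≤
      if t η ζ then 1 / classMass p t η else 0 := by
  classical
  by_cases h : ∃ ω, r ω η ∧ s ω ζ
  · obtain ⟨ω₀, h₁, h₂⟩ := h
    have ht : t η ζ := t.trans' (t.symm' (hr h₁)) (hs h₂)
    rw [if_pos ht]
    -- The admissible `ω` form the `r ⊓ s`-class of `ω₀`, on which both masses in the denominator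
    -- are constant.
    have key : ∀ ω, (if r ω η ∧ s ω ζ then
        p ω / (classMass p (r ⊓ s) ω * classMass p t ω) else 0) =
        (if (r ⊓ s) ω₀ ω then p ω else 0) *
          (1 / (classMass p (r ⊓ s) ω₀ * classMass p t η)) := by
      intro ω
      have e : (r ω η ∧ s ω ζ) ↔ (r ⊓ s) ω₀ ω := by
        change _ ↔ r ω₀ ω ∧ s ω₀ ω
        constructor
        · rintro ⟨a, b⟩
          exact ⟨r.trans' h₁ (r.symm' a), s.trans' h₂ (s.symm' b)⟩
        · rintro ⟨a, b⟩
          exact ⟨r.trans' (r.symm' a) h₁, s.trans' (s.symm' b) h₂⟩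
      by_cases hω : r ω η ∧ s ω ζ
      · rw [if_pos hω, if_pos (e.1 hω), classMass_congr (r ⊓ s) (e.1 hω),
          classMass_congr t (hr hω.1)]
        ring
      · rw [if_neg hω, if_neg (fun h => hω (e.2 h)), zero_mul]
    rw [Finset.sum_congr rfl fun ω _ => key ω, ← Finset.sum_mul]
    change classMass p (r ⊓ s) ω₀ * _ ≤ _
    -- A class of mass zero contributes `0`; otherwise its mass cancels and equality holds.
    rcases (hp.classMass_nonneg (r ⊓ s) ω₀).eq_or_lt with h0 | h0
    · rw [← h0]
      simpa using hp.classMass_nonneg t η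
    · apply le_of_eq
      field_simp
  · push Not at h
    rw [Finset.sum_eq_zero fun ω _ => if_neg fun hω => h ω hω.1 hω.2]
    split_ifs
    · exact one_div_nonneg.2 (hp.classMass_nonneg t η)
    · exact le_rfl

/-- The ratio compares the law making `r` and `s` conditionally independent given `t` with the true
joint law, so its mean is at most a total mass of `1`. Concretely, the product of the masses of `r`
and `s` is a double sum over `η` and `ζ`; summing over `ω` first leaves at most `p η * p ζ /
classMass p t η` on the pairs with `t η ζ`. -/
theorem IsDistribution.sum_ratio_le_one (hp : IsDistribution p) {r s t : Setoid Ω} (hr : r ≤ t)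
    (hs : s ≤ t) :
    ∑ ω, p ω * (classMass p r ω * classMass p s ω /
      (classMass p (r ⊓ s) ω * classMass p t ω)) ≤ 1 := by
  classical
  have h1 : ∑ ω, p ω * (classMass p r ω * classMass p s ω /
      (classMass p (r ⊓ s) ω * classMass p t ω)) =
      ∑ η, ∑ ζ, p η * p ζ * ∑ ω, if r ω η ∧ s ω ζ then
        p ω / (classMass p (r ⊓ s) ω * classMass p t ω) else 0 := by
    simp_rw [Finset.mul_sum]
    rw [Finset.sum_congr rfl fun η _ => Finset.sum_comm, Finset.sum_comm]
    refine Finset.sum_congr rfl fun ω _ => ?_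
    have : classMass p r ω * classMass p s ω =
        ∑ η, ∑ ζ, if r ω η ∧ s ω ζ then p η * p ζ else 0 := by
      unfold classMass
      rw [Finset.sum_mul_sum]
      refine Finset.sum_congr rfl fun η _ => Finset.sum_congr rfl fun ζ _ => ?_
      by_cases h1 : r ω η <;> by_cases h2 : s ω ζ <;> simp [h1, h2]
    rw [this, Finset.sum_div, Finset.mul_sum]
    refine Finset.sum_congr rfl fun η _ => ?_
    rw [Finset.sum_div, Finset.mul_sum]
    refine Finset.sum_congr rfl fun ζ _ => ?_
    split_ifs <;> ring
  rw [h1]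
  calc _ ≤ ∑ η, ∑ ζ, p η * p ζ * (if t η ζ then 1 / classMass p t η else 0) := by
        refine Finset.sum_le_sum fun η _ => Finset.sum_le_sum fun ζ _ => ?_
        exact mul_le_mul_of_nonneg_left (hp.sum_inter_le hr hs η ζ)
          (mul_nonneg (hp.nonneg _) (hp.nonneg _))
    _ = ∑ η, p η * (classMass p t η / classMass p t η) := by
        refine Finset.sum_congr rfl fun η _ => ?_
        conv_rhs => rw [classMass, Finset.sum_div, Finset.mul_sum]
        refine Finset.sum_congr rfl fun ζ _ => ?_
        split_ifs
        · rw [classMass]; ring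
        · simp
    _ ≤ ∑ η, p η := Finset.sum_le_sum fun η _ =>
        mul_le_of_le_one_right (hp.nonneg η) (div_self_le_one _)
    _ = 1 := hp.sum_eq_one

/-- Conditional mutual information is nonnegative. -/
theorem IsDistribution.partitionEntropy_submodular (hp : IsDistribution p) {r s t : Setoid Ω}
    (hr : r ≤ t) (hs : s ≤ t) :
    partitionEntropy p (r ⊓ s) + partitionEntropy p t ≤
      partitionEntropy p r + partitionEntropy p s := by
  have h := hp.sum_ratio_le_one hr hs
  -- This is `log x ≤ x - 1` at the ratio of masses, weighted by `p ω`; all four masses are positive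
  -- where `p ω ≠ 0`.
  have key : ∀ ω, p ω - p ω * (classMass p r ω * classMass p s ω /
      (classMass p (r ⊓ s) ω * classMass p t ω)) ≤
      p ω * Real.log (classMass p (r ⊓ s) ω) + p ω * Real.log (classMass p t ω) -
      p ω * Real.log (classMass p r ω) - p ω * Real.log (classMass p s ω) := by
    intro ω
    by_cases hω : p ω = 0
    · simp [hω]
    have a := hp.classMass_pos r hω
    have b := hp.classMass_pos s hω
    have c := hp.classMass_pos (r ⊓ s) hω
    have d := hp.classMass_pos t hω
    have hl := Real.log_le_sub_one_of_pos (div_pos (mul_pos a b) (mul_pos c d))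
    rw [Real.log_div (mul_pos a b).ne' (mul_pos c d).ne', Real.log_mul a.ne' b.ne',
      Real.log_mul c.ne' d.ne'] at hl
    nlinarith [mul_le_mul_of_nonneg_left hl (hp.nonneg ω)]
  have hs := Finset.sum_le_sum fun ω (_ : ω ∈ Finset.univ) => key ω
  simp only [Finset.sum_sub_distrib, Finset.sum_add_distrib, hp.sum_eq_one] at hs
  unfold partitionEntropy
  linarith

/-- The entropy of a partition depends only on its restriction to the support. -/
theorem partitionEntropy_congr {r s : Setoid Ω}
    (h : ∀ ω η, p ω ≠ 0 → p η ≠ 0 → (r ω η ↔ s ω η)) :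
    partitionEntropy p r = partitionEntropy p s := by
  classical
  unfold partitionEntropy classMass
  congr 1
  refine Finset.sum_congr rfl fun ω _ => ?_
  by_cases hω : p ω = 0
  · simp [hω]
  congr 2
  refine Finset.sum_congr rfl fun η _ => ?_
  by_cases hη : p η = 0
  · simp [hη]
  simp [h ω η hω hη]

theorem IsDistribution.partitionEntropy_top (hp : IsDistribution p) :
    partitionEntropy p ⊤ = 0 := by
  classical
  have : ∀ ω, classMass p ⊤ ω = 1 := fun ω => by simp [classMass, Setoid.top_def, hp.sum_eq_one]
  simp [partitionEntropy, this]

end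

/-! ### Conditionally independent copies -/

section

variable {Ω : Type} [Fintype Ω] {p : Ω → ℝ}

open Classical in
/-- The distribution of two copies of a random point, which are conditionally independent given
their common class under `c`. -/
noncomputable def condIndepCopy (p : Ω → ℝ) (c : Setoid Ω) (x : Ω × Ω) : ℝ :=
  if c x.1 x.2 then p x.1 * p x.2 / classMass p c x.1 else 0

theorem condIndepCopy_ne_zero {c : Setoid Ω} {x : Ω × Ω} (h : condIndepCopy p c x ≠ 0) :
    c x.1 x.2 ∧ p x.1 ≠ 0 ∧ p x.2 ≠ 0 := by
  classical
  unfold condIndepCopy at h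
  split_ifs at h with hc
  · refine ⟨hc, fun h0 => h ?_, fun h0 => h ?_⟩ <;> simp [h0]
  · exact absurd rfl h

theorem condIndepCopy_swap (c : Setoid Ω) (ω η : Ω) :
    condIndepCopy p c (ω, η) = condIndepCopy p c (η, ω) := by
  classical
  unfold condIndepCopy
  by_cases h : c ω η
  · simp only [if_pos h, if_pos (c.symm' h), classMass_congr c h, mul_comm]
  · simp only [if_neg h, if_neg fun h' => h (c.symm' h')]

/-- Given the first point, the second is drawn from its `c`-class with normalised weights, so the
first marginal remains `p`. -/
theorem IsDistribution.sum_condIndepCopy_left (hp : IsDistribution p) (c : Setoid Ω) (ω : Ω) :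
    ∑ η, condIndepCopy p c (ω, η) = p ω := by
  classical
  by_cases hω : p ω = 0
  · simp [condIndepCopy, hω]
  have hpos := (hp.classMass_pos c hω).ne'
  have : ∀ η, condIndepCopy p c (ω, η) = p ω / classMass p c ω * if c ω η then p η else 0 := by
    intro η
    unfold condIndepCopy
    split_ifs
    · ring
    · simp
  rw [Finset.sum_congr rfl fun η _ => this η, ← Finset.mul_sum]
  change _ * classMass p c ω = _
  field_simp

theorem IsDistribution.sum_condIndepCopy_right (hp : IsDistribution p) (c : Setoid Ω) (η : Ω) :
    ∑ ω, condIndepCopy p c (ω, η) = p η := by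
  rw [Finset.sum_congr rfl fun ω _ => condIndepCopy_swap c ω η, hp.sum_condIndepCopy_left]

theorem IsDistribution.copy (hp : IsDistribution p) (c : Setoid Ω) :
    IsDistribution (condIndepCopy p c) where
  nonneg x := by
    classical
    unfold condIndepCopy
    split_ifs
    · exact div_nonneg (mul_nonneg (hp.nonneg _) (hp.nonneg _)) (hp.classMass_nonneg _ _)
    · exact le_rfl
  sum_eq_one := by
    rw [Fintype.sum_prod_type, Finset.sum_congr rfl fun ω _ => hp.sum_condIndepCopy_left c ω,
      hp.sum_eq_one]

theorem IsDistribution.classMass_comap_fst (hp : IsDistribution p) (c r : Setoid Ω) (x : Ω × Ω) :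
    classMass (condIndepCopy p c) (r.comap Prod.fst) x = classMass p r x.1 := by
  classical
  unfold classMass
  rw [Fintype.sum_prod_type]
  refine Finset.sum_congr rfl fun ω _ => ?_
  by_cases h : r x.1 ω
  · simp [Setoid.comap_rel, h, hp.sum_condIndepCopy_left]
  · simp [Setoid.comap_rel, h]

theorem IsDistribution.classMass_comap_snd (hp : IsDistribution p) (c r : Setoid Ω) (x : Ω × Ω) :
    classMass (condIndepCopy p c) (r.comap Prod.snd) x = classMass p r x.2 := by
  classical
  unfold classMass
  rw [Fintype.sum_prod_type, Finset.sum_comm]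
  refine Finset.sum_congr rfl fun ω _ => ?_
  by_cases h : r x.2 ω
  · simp [Setoid.comap_rel, h, hp.sum_condIndepCopy_right]
  · simp [Setoid.comap_rel, h]

theorem IsDistribution.sum_condIndepCopy_fst_mul (hp : IsDistribution p) (c : Setoid Ω)
    (f : Ω → ℝ) : ∑ x, condIndepCopy p c x * f x.1 = ∑ ω, p ω * f ω := by
  rw [Fintype.sum_prod_type]
  refine Finset.sum_congr rfl fun ω _ => ?_
  simp only [← Finset.sum_mul, hp.sum_condIndepCopy_left]

theorem IsDistribution.sum_condIndepCopy_snd_mul (hp : IsDistribution p) (c : Setoid Ω)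
    (f : Ω → ℝ) : ∑ x, condIndepCopy p c x * f x.2 = ∑ ω, p ω * f ω := by
  rw [Fintype.sum_prod_type, Finset.sum_comm]
  refine Finset.sum_congr rfl fun ω _ => ?_
  simp only [← Finset.sum_mul, hp.sum_condIndepCopy_right]

theorem IsDistribution.partitionEntropy_comap_fst (hp : IsDistribution p) (c r : Setoid Ω) :
    partitionEntropy (condIndepCopy p c) (r.comap Prod.fst) =
      partitionEntropy p r := by
  unfold partitionEntropy
  simp_rw [hp.classMass_comap_fst]
  rw [hp.sum_condIndepCopy_fst_mul c fun ω => Real.log (classMass p r ω)]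

theorem IsDistribution.partitionEntropy_comap_snd (hp : IsDistribution p) (c r : Setoid Ω) :
    partitionEntropy (condIndepCopy p c) (r.comap Prod.snd) =
      partitionEntropy p r := by
  unfold partitionEntropy
  simp_rw [hp.classMass_comap_snd]
  rw [hp.sum_condIndepCopy_snd_mul c fun ω => Real.log (classMass p r ω)]

/-- The second coordinate has the same joint distribution with the common part as the first. -/
theorem IsDistribution.partitionEntropy_copy (hp : IsDistribution p) {c r : Setoid Ω} (hr : c ≤ r)
    (s : Setoid Ω) :
    partitionEntropy (condIndepCopy p c)
      (r.comap Prod.fst ⊓ s.comap Prod.snd) = partitionEntropy p (r ⊓ s) := by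
  rw [← hp.partitionEntropy_comap_snd c]
  -- On the support both coordinates lie in one class of `c`, hence of the coarser `r`, so `r` may
  -- be read from the second coordinate.
  refine partitionEntropy_congr fun x y hx hy => ?_
  have h1 := hr (condIndepCopy_ne_zero hx).1
  have h2 := hr (condIndepCopy_ne_zero hy).1
  change (r x.1 y.1 ∧ s x.2 y.2) ↔ (r x.2 y.2 ∧ s x.2 y.2)
  exact and_congr_left fun _ => ⟨fun h => r.trans' (r.symm' h1) (r.trans' h h2),
    fun h => r.trans' h1 (r.trans' h (r.symm' h2))⟩

/-- The class of `x` is the product of an `r`-class and an `s`-class inside one `c`-class, where the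
copy has the product density divided by a constant. -/
theorem classMass_condIndep {c r s : Setoid Ω}
    (hr : r ≤ c) (hs : s ≤ c) {x : Ω × Ω} (hx : c x.1 x.2) :
    classMass (condIndepCopy p c) (r.comap Prod.fst ⊓ s.comap Prod.snd) x =
      classMass p r x.1 * classMass p s x.2 / classMass p c x.1 := by
  classical
  have key : ∀ ω η, (if (r.comap Prod.fst ⊓ s.comap Prod.snd : Setoid (Ω × Ω)) x (ω, η) then
      condIndepCopy p c (ω, η) else 0) =
      ((if r x.1 ω then p ω else 0) * if s x.2 η then p η else 0) / classMass p c x.1 := by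
    intro ω η
    have e : (r.comap Prod.fst ⊓ s.comap Prod.snd : Setoid (Ω × Ω)) x (ω, η) ↔
      r x.1 ω ∧ s x.2 η := Iff.rfl
    by_cases h1 : r x.1 ω
    · by_cases h2 : s x.2 η
      · have hc : c ω η := c.trans' (c.symm' (hr h1)) (c.trans' hx (hs h2))
        rw [if_pos (e.2 ⟨h1, h2⟩), if_pos h1, if_pos h2, condIndepCopy, if_pos hc,
          classMass_congr c (hr h1)]
      · rw [if_neg fun h => h2 (e.1 h).2, if_neg h2]
        simp
    · rw [if_neg fun h => h1 (e.1 h).1, if_neg h1]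
      simp
  unfold classMass at key ⊢
  rw [Fintype.sum_prod_type, Finset.sum_mul_sum, Finset.sum_div]
  refine Finset.sum_congr rfl fun ω _ => ?_
  rw [Finset.sum_div]
  exact Finset.sum_congr rfl fun η _ => key ω η

/-- The two coordinates are conditionally independent given the common part. -/
theorem IsDistribution.partitionEntropy_condIndep (hp : IsDistribution p) {c r s : Setoid Ω}
    (hr : r ≤ c) (hs : s ≤ c) :
    partitionEntropy (condIndepCopy p c) (r.comap Prod.fst ⊓ s.comap Prod.snd) =
      partitionEntropy p r + partitionEntropy p s - partitionEntropy p c := by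
  have key : ∀ x, condIndepCopy p c x * Real.log
      (classMass (condIndepCopy p c) (r.comap Prod.fst ⊓ s.comap Prod.snd) x) =
      condIndepCopy p c x * Real.log (classMass p r x.1) +
      condIndepCopy p c x * Real.log (classMass p s x.2) -
      condIndepCopy p c x * Real.log (classMass p c x.1) := by
    intro x
    by_cases hx : condIndepCopy p c x = 0
    · simp [hx]
    obtain ⟨h, h1, h2⟩ := condIndepCopy_ne_zero hx
    rw [classMass_condIndep hr hs h, Real.log_div, Real.log_mul]
    · ring
    · exact (hp.classMass_pos r h1).ne'
    · exact (hp.classMass_pos s h2).ne'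
    · exact mul_ne_zero (hp.classMass_pos r h1).ne' (hp.classMass_pos s h2).ne'
    · exact (hp.classMass_pos c h1).ne'
  unfold partitionEntropy
  rw [Finset.sum_congr rfl fun x _ => key x, Finset.sum_sub_distrib, Finset.sum_add_distrib,
    hp.sum_condIndepCopy_fst_mul c fun ω => Real.log (classMass p r ω),
    hp.sum_condIndepCopy_fst_mul c fun ω => Real.log (classMass p c ω),
    hp.sum_condIndepCopy_snd_mul c fun ω => Real.log (classMass p s ω)]
  ring

end

/-! ### Families of partitions indexed by bit masks -/

/-- The common refinement of the partitions `X i`, where `i` runs over the binary digits of `m`. -/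
def jointPartition {Ω : Type} (X : ℕ → Setoid Ω) (m : ℕ) : Setoid Ω where
  r ω η := ∀ i, m.testBit i → X i ω η
  iseqv := ⟨fun _ i _ => (X i).refl' _, fun h i hi => (X i).symm' (h i hi),
    fun h h' i hi => (X i).trans' (h i hi) (h' i hi)⟩

theorem jointPartition_or {Ω : Type} (X : ℕ → Setoid Ω) (m m' : ℕ) :
    jointPartition X (m ||| m') = jointPartition X m ⊓ jointPartition X m' := by
  ext ω η
  change (∀ i, (m ||| m').testBit i → X i ω η) ↔
    (∀ i, m.testBit i → X i ω η) ∧ (∀ i, m'.testBit i → X i ω η)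
  simp only [Nat.testBit_or, Bool.or_eq_true]
  exact ⟨fun h => ⟨fun i hi => h i (.inl hi), fun i hi => h i (.inr hi)⟩,
    fun h i hi => hi.elim (h.1 i) (h.2 i)⟩

theorem jointPartition_zero {Ω : Type} (X : ℕ → Setoid Ω) : jointPartition X 0 = ⊤ := by
  ext ω η
  exact iff_of_true (fun i hi => by simp at hi) trivial

/-- `h` is the entropy function of jointly distributed random variables with finite ranges,
indexed by the natural numbers; a set of indices is given by its bit mask. -/
def IsEntropic (h : ℕ → ℝ) : Prop :=
  ∃ (Ω : Type) (_ : Fintype Ω) (p : Ω → ℝ) (X : ℕ → Setoid Ω), IsDistribution p ∧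
    ∀ m, h m = partitionEntropy p (jointPartition X m)

theorem IsEntropic.map_zero {h : ℕ → ℝ} (hh : IsEntropic h) : h 0 = 0 := by
  obtain ⟨Ω, _, p, X, hp, hX⟩ := hh
  rw [hX, jointPartition_zero, hp.partitionEntropy_top]

theorem IsEntropic.submodular {h : ℕ → ℝ} (hh : IsEntropic h) (x y z : ℕ) :
    h (x ||| y ||| z) + h z ≤ h (x ||| z) + h (y ||| z) := by
  obtain ⟨Ω, _, p, X, hp, hX⟩ := hh
  have h1 := hp.partitionEntropy_submodular (r := jointPartition X (x ||| z))
    (s := jointPartition X (y ||| z)) (t := jointPartition X z)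
    (by rw [jointPartition_or]; exact inf_le_right)
    (by rw [jointPartition_or]; exact inf_le_right)
  rw [← jointPartition_or] at h1
  have e : x ||| z ||| (y ||| z) = x ||| y ||| z := by
    apply Nat.eq_of_testBit_eq
    intro i
    simp only [Nat.testBit_or]
    cases x.testBit i <;> cases y.testBit i <;> cases z.testBit i <;> rfl
  rw [e] at h1
  simpa only [hX] using h1

/-! ### The copy lemma and its iteration -/

/-- The union of the masks `gs[q]`, where `q` runs over the binary digits of `b`. -/
def mergedMask : List ℕ → ℕ → ℕ
  | [], _ => 0
  | g :: gs, b => (if b % 2 = 1 then g else 0) ||| mergedMask gs (b / 2)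

theorem testBit_mergedMask (gs : List ℕ) (b i : ℕ) :
    (mergedMask gs b).testBit i ↔ ∃ q, b.testBit q ∧ (gs.getD q 0).testBit i := by
  induction gs generalizing b with
  | nil => simp [mergedMask]
  | cons g gs ih =>
    rw [mergedMask, Nat.testBit_or, Bool.or_eq_true, ih]
    constructor
    · rintro (h | ⟨q, hq, hi⟩)
      · split_ifs at h with hb
        · exact ⟨0, by simpa [Nat.testBit_zero] using hb, by simpa using h⟩
        · simp at h
      · exact ⟨q + 1, by rwa [Nat.testBit_add_one], by simpa using hi⟩
    · rintro ⟨q, hq, hi⟩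
      cases q with
      | zero =>
        left
        have hb : b % 2 = 1 := by simpa [Nat.testBit_zero] using hq
        simpa [hb] using hi
      | succ q => exact Or.inr ⟨q, by rwa [Nat.testBit_add_one] at hq, by simpa using hi⟩

theorem mergedMask_lt {gs : List ℕ} {k : ℕ} (hgs : ∀ g ∈ gs, g < 2 ^ k) (b : ℕ) :
    mergedMask gs b < 2 ^ k := by
  induction gs generalizing b with
  | nil => exact Nat.two_pow_pos k
  | cons g gs ih =>
    refine Nat.or_lt_two_pow ?_ (ih (fun g' hg' => hgs g' (List.mem_cons_of_mem _ hg')) _)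
    split_ifs
    · exact hgs g List.mem_cons_self
    · exact Nat.two_pow_pos k

/-- In the entropy function `h`, the variables with indices `k, k + 1, …` are a joint copy of the
variables obtained by merging each of the groups `gs`; the copy has the same joint distribution with
the variables of `C`, and given these is independent of the other variables with index below `k`. -/
def IsCopy (h : ℕ → ℝ) (k C : ℕ) (gs : List ℕ) : Prop :=
  -- The bound leaves all higher indices free, to be filled by later copy steps.
  ∀ m < 2 ^ (k + gs.length),
    (m % 2 ^ k &&& C = m % 2 ^ k → h m = h (m % 2 ^ k ||| mergedMask gs (m / 2 ^ k))) ∧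
    (m % 2 ^ k &&& C = C →
      h m = h (m % 2 ^ k) + h (mergedMask gs (m / 2 ^ k) ||| C) - h C)

/-- The copy lemma. -/
theorem IsEntropic.exists_copy {h : ℕ → ℝ} (hh : IsEntropic h) {k C : ℕ} {gs : List ℕ}
    (hC : C < 2 ^ k) (hgs : ∀ g ∈ gs, g < 2 ^ k) :
    ∃ h', IsEntropic h' ∧ (∀ m < 2 ^ k, h' m = h m) ∧ IsCopy h' k C gs := by
  obtain ⟨Ω, _, p, X, hp, hX⟩ := hh
  -- Old variables read the first coordinate, copies the second. Former variables with index at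
  -- least `k` are overwritten, and indices past the last group get the mask `0`, hence a constant
  -- variable.
  obtain ⟨X', hlo, hhi⟩ : ∃ X' : ℕ → Setoid (Ω × Ω),
      (∀ i, i < k → X' i = (X i).comap Prod.fst) ∧
      ∀ i, ¬i < k → X' i = (jointPartition X (gs.getD (i - k) 0)).comap Prod.snd :=
    ⟨fun i => if i < k then (X i).comap Prod.fst else
      (jointPartition X (gs.getD (i - k) 0)).comap Prod.snd, fun _ h => if_pos h, fun _ h => if_neg h⟩
  let c := jointPartition X C
  have hX' : ∀ m, jointPartition X' m = (jointPartition X (m % 2 ^ k)).comap Prod.fst ⊓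
      (jointPartition X (mergedMask gs (m / 2 ^ k))).comap Prod.snd := by
    intro m
    ext x y
    change (∀ i, m.testBit i → X' i x y) ↔ (∀ i, (m % 2 ^ k).testBit i → X i x.1 y.1) ∧
      (∀ i, (mergedMask gs (m / 2 ^ k)).testBit i → X i x.2 y.2)
    constructor
    · intro H
      refine ⟨fun i hi => ?_, fun i hi => ?_⟩
      · rw [Nat.testBit_mod_two_pow, Bool.and_eq_true, decide_eq_true_eq] at hi
        have := H i hi.2
        rwa [hlo i hi.1] at this
      · obtain ⟨q, hq, hqi⟩ := (testBit_mergedMask _ _ _).1 hi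
        rw [Nat.testBit_div_two_pow] at hq
        have := H _ hq
        rw [hhi _ (Nat.not_lt.2 (Nat.le_add_left k q)), Nat.add_sub_cancel] at this
        exact this i hqi
    · rintro ⟨H1, H2⟩ i hi
      by_cases hik : i < k
      · rw [hlo i hik]
        exact H1 i (by simp [Nat.testBit_mod_two_pow, hik, hi])
      · rw [hhi i hik]
        intro j hj
        refine H2 j ((testBit_mergedMask _ _ _).2 ⟨i - k, ?_, hj⟩)
        rwa [Nat.testBit_div_two_pow, Nat.sub_add_cancel (Nat.not_lt.1 hik)]
  let h' : ℕ → ℝ := fun m => partitionEntropy (condIndepCopy p c) (jointPartition X' m)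
  have hlow : ∀ m < 2 ^ k, h' m = h m := by
    intro m hm
    have : jointPartition X' m = (jointPartition X m).comap Prod.fst := by
      rw [hX', Nat.mod_eq_of_lt hm, Nat.div_eq_of_lt hm]
      have h0 : mergedMask gs 0 = 0 := by
        apply Nat.eq_of_testBit_eq
        intro i
        rw [Bool.eq_iff_iff, testBit_mergedMask]
        simp
      rw [h0, jointPartition_zero]
      exact inf_eq_left.2 fun _ _ _ => trivial
    simp only [h', this, hp.partitionEntropy_comap_fst, hX]
  refine ⟨h', ⟨Ω × Ω, inferInstance, _, X', hp.copy c, fun _ => rfl⟩, hlow, fun m _ => ?_⟩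
  have hu : m % 2 ^ k < 2 ^ k := Nat.mod_lt _ (Nat.two_pow_pos k)
  have hb := mergedMask_lt hgs (m / 2 ^ k)
  have hle : ∀ {a b : ℕ}, a &&& b = b → jointPartition X a ≤ jointPartition X b := by
    intro a b hab ω η H i hi
    refine H i ?_
    rw [← hab, Nat.testBit_and, Bool.and_eq_true] at hi
    exact hi.1
  constructor
  · intro hsub
    rw [hlow _ (Nat.or_lt_two_pow hu hb), hX, jointPartition_or]
    simp only [h', hX']
    exact hp.partitionEntropy_copy (hle (by rwa [Nat.and_comm])) _
  · intro hsup
    rw [hlow _ hu, hlow _ (Nat.or_lt_two_pow hb hC), hlow _ hC, hX, hX, hX, jointPartition_or]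
    simp only [h', hX']
    rw [← hp.partitionEntropy_condIndep (hle hsup) inf_le_right]
    -- Conditional independence needs `C` on both sides. On the second it is already implied: the
    -- old part of `m` contains `C`, and the two coordinates agree modulo `c` on the support.
    refine partitionEntropy_congr fun x y hx hy => ?_
    have h1 := (condIndepCopy_ne_zero hx).1
    have h2 := (condIndepCopy_ne_zero hy).1
    change (_ ∧ _) ↔ (_ ∧ _ ∧ c x.2 y.2)
    refine ⟨fun H => ⟨H.1, H.2, ?_⟩, fun H => ⟨H.1, H.2.1⟩⟩
    exact c.trans' (c.symm' h1) (c.trans' (hle hsup H.1) h2)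

/-- A copy step: the number of variables before the step, the mask of the variables over which the
copy is made, and the masks of the groups of variables which are merged and copied. -/
structure CopyStep where
  size : ℕ
  base : ℕ
  groups : List ℕ

/-- The steps (the last one first) can be performed one after the other, starting with `n` variables
and ending with `k`. -/
def CopyStep.WellFormed (n : ℕ) : List CopyStep → ℕ → Prop
  | [], k => k = n
  | s :: ss, k => k = s.size + s.groups.length ∧ s.base < 2 ^ s.size ∧
      (∀ g ∈ s.groups, g < 2 ^ s.size) ∧ CopyStep.WellFormed n ss s.size

instance CopyStep.decidableWellFormed (n : ℕ) :
    ∀ (ss : List CopyStep) (k : ℕ), Decidable (CopyStep.WellFormed n ss k)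
  | [], k => by unfold CopyStep.WellFormed; infer_instance
  | s :: ss, k =>
    have := CopyStep.decidableWellFormed n ss s.size
    by unfold CopyStep.WellFormed; infer_instance

theorem CopyStep.WellFormed.le {n : ℕ} : ∀ {ss : List CopyStep} {k : ℕ},
    CopyStep.WellFormed n ss k → n ≤ k
  | [], _, h => by rw [CopyStep.WellFormed] at h; exact h.ge
  | _ :: _, _, h => h.1 ▸ (CopyStep.WellFormed.le h.2.2.2).trans (Nat.le_add_right _ _)

/-- Only masks below `2 ^ (k + gs.length)` occur in the copy equations, so an extension by further
copies preserves them. -/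
theorem IsCopy.congr {h h' : ℕ → ℝ} {k C : ℕ} {gs : List ℕ} (hc : IsCopy h k C gs)
    (hC : C < 2 ^ k) (hgs : ∀ g ∈ gs, g < 2 ^ k)
    (hh : ∀ m < 2 ^ (k + gs.length), h' m = h m) : IsCopy h' k C gs := by
  intro m hm
  have hk : 2 ^ k ≤ 2 ^ (k + gs.length) := Nat.pow_le_pow_right two_pos (Nat.le_add_right _ _)
  have hu : m % 2 ^ k < 2 ^ k := Nat.mod_lt _ (Nat.two_pow_pos k)
  have hb := mergedMask_lt hgs (m / 2 ^ k)
  rw [hh m hm, hh _ ((Nat.or_lt_two_pow hu hb).trans_le hk), hh _ (hu.trans_le hk),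
    hh _ ((Nat.or_lt_two_pow hb hC).trans_le hk), hh _ (hC.trans_le hk)]
  exact hc m hm

/-- Iterated copy lemma. -/
theorem IsEntropic.exists_copies {h : ℕ → ℝ} (hh : IsEntropic h) {n : ℕ} :
    ∀ {ss : List CopyStep} {k : ℕ}, CopyStep.WellFormed n ss k →
      ∃ h', IsEntropic h' ∧ (∀ m < 2 ^ n, h' m = h m) ∧
        ∀ s ∈ ss, IsCopy h' s.size s.base s.groups
  | [], _, _ => ⟨h, hh, fun _ _ => rfl, by simp⟩
  | s :: ss, k, ⟨_, hC, hgs, hw⟩ => by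
    obtain ⟨h₁, hh₁, hl₁, hc₁⟩ := IsEntropic.exists_copies hh hw
    obtain ⟨h₂, hh₂, hl₂, hc₂⟩ := hh₁.exists_copy hC hgs
    refine ⟨h₂, hh₂, fun m hm => ?_, fun t ht => ?_⟩
    · rw [hl₂ m (hm.trans_le (Nat.pow_le_pow_right two_pos hw.le)), hl₁ m hm]
    · rcases List.mem_cons.1 ht with rfl | ht
      · exact hc₂
      -- Every earlier step involves only indices below the size at which the last step starts,
      -- where that step changes nothing.
      · have hts : ∀ {ss : List CopyStep} {k : ℕ}, CopyStep.WellFormed n ss k → ∀ t ∈ ss,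
            t.size + t.groups.length ≤ k ∧ t.base < 2 ^ t.size ∧
              ∀ g ∈ t.groups, g < 2 ^ t.size := by
          intro ss
          induction ss with
          | nil => simp
          | cons s ss ih =>
            rintro k ⟨hk, h1, h2, h3⟩ t ht
            rcases List.mem_cons.1 ht with rfl | ht
            · exact ⟨hk.ge, h1, h2⟩
            · obtain ⟨a, b, c⟩ := ih h3 t ht
              exact ⟨by omega, b, c⟩
        obtain ⟨a, b, c⟩ := hts hw t ht
        exact (hc₁ t ht).congr b c fun m hm =>
          hl₂ m (hm.trans_le (Nat.pow_le_pow_right two_pos a))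

/-! ### The entropy function of a scheme -/

/-- The mass of an atom of the image law is that of a fibre of `f`; spreading each entropy term over
its fibre gives the sum over points. -/
theorem entropy_map {Ω α : Type} [Fintype Ω] [Fintype α] (law : PMF Ω) (f : Ω → α) :
    entropy (law.map f) = partitionEntropy (fun ω => (law ω).toReal) (Setoid.ker f) := by
  classical
  have hmap : ∀ a, ((law.map f) a).toReal = ∑ ω, if f ω = a then (law ω).toReal else 0 := by
    intro a
    rw [PMF.map_apply, tsum_fintype, ENNReal.toReal_sum]
    · refine Finset.sum_congr rfl fun ω _ => ?_
      by_cases h : f ω = a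
      · simp [h]
      · simp [h, Ne.symm h]
    · intro ω _
      split_ifs
      · exact law.apply_ne_top ω
      · exact ENNReal.zero_ne_top
  have hmass : ∀ ω, classMass (fun ω => (law ω).toReal) (Setoid.ker f) ω =
      ((law.map f) (f ω)).toReal := by
    intro ω
    rw [hmap]
    refine Finset.sum_congr rfl fun η _ => ?_
    simp only [Setoid.ker_def, eq_comm]
  have hsum : ∀ a, Real.negMulLog ((law.map f) a).toReal =
      ∑ ω, if f ω = a then -((law ω).toReal * Real.log ((law.map f) a).toReal) else 0 := by
    intro a
    rw [Real.negMulLog, neg_mul, ← mul_neg]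
    nth_rw 1 [hmap a]
    rw [Finset.sum_mul]
    refine Finset.sum_congr rfl fun ω _ => ?_
    split_ifs <;> simp
  rw [entropy, Finset.sum_congr rfl fun a _ => hsum a, Finset.sum_comm, partitionEntropy,
    ← Finset.sum_neg_distrib]
  refine Finset.sum_congr rfl fun ω _ => ?_
  rw [Finset.sum_ite_eq, if_pos (Finset.mem_univ _), hmass]

/-- The set of indices with bit mask `m`. -/
def maskSet (n m : ℕ) : Finset (Fin (n + 1)) :=
  Finset.univ.filter fun i => m.testBit i

theorem mem_maskSet {n m : ℕ} {i : Fin (n + 1)} : i ∈ maskSet n m ↔ m.testBit i := by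
  simp [maskSet]

theorem maskSet_or (n m m' : ℕ) : maskSet n (m ||| m') = maskSet n m ∪ maskSet n m' := by
  ext i
  simp [mem_maskSet]

theorem maskSet_two_pow {n : ℕ} (i : Fin (n + 1)) : maskSet n (2 ^ (i : ℕ)) = {i} := by
  ext j
  rw [mem_maskSet, Nat.testBit_two_pow, decide_eq_true_eq, Finset.mem_singleton, Fin.ext_iff,
    eq_comm]

theorem isDistribution_toReal {Ω : Type} [Fintype Ω] (law : PMF Ω) :
    IsDistribution fun ω => (law ω).toReal where
  nonneg _ := ENNReal.toReal_nonneg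
  sum_eq_one := by
    rw [← ENNReal.toReal_sum fun ω _ => law.apply_ne_top ω, ← tsum_fintype (L := .unconditional Ω), law.tsum_coe,
      ENNReal.toReal_one]

/-- The sample space is the space of tuples, partitioned by each coordinate; equality of sub-tuples
is coordinatewise equality. Indices above `n` carry the trivial partition. -/
theorem exists_isEntropic {n : ℕ} {S : Fin (n + 1) → Type} [∀ i, Fintype (S i)]
    (law : PMF (∀ i, S i)) :
    ∃ h, IsEntropic h ∧ ∀ m, h m = jointEntropy law (maskSet n m) := by
  classical
  obtain ⟨X, hlo, hhi⟩ : ∃ X : ℕ → Setoid (∀ i, S i),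
      (∀ i (hi : i < n + 1), X i = Setoid.ker fun ω => ω ⟨i, hi⟩) ∧
      ∀ i, ¬i < n + 1 → X i = ⊤ :=
    ⟨fun i => if hi : i < n + 1 then Setoid.ker fun ω => ω ⟨i, hi⟩ else ⊤,
      fun _ h => dif_pos h, fun _ h => dif_neg h⟩
  refine ⟨_, ⟨_, inferInstance, _, X, isDistribution_toReal law, fun _ => rfl⟩, fun m => ?_⟩
  rw [jointEntropy, entropy_map]
  congr 1
  ext ω η
  change (∀ i, m.testBit i → X i ω η) ↔
    (fun j : maskSet n m => ω j) = (fun j : maskSet n m => η j)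
  rw [funext_iff]
  constructor
  · rintro H ⟨i, hi⟩
    have h := H i (mem_maskSet.1 hi)
    rwa [hlo i i.isLt] at h
  · intro H i hi
    by_cases hin : i < n + 1
    · rw [hlo i hin]
      exact H ⟨⟨i, hin⟩, mem_maskSet.2 hi⟩
    · rw [hhi i hin]
      trivial

/-- In the entropy function `h`, the variable with index `0` is a secret shared perfectly by the
variables with indices `1, …, n`, where the masks of the minimal accepted coalitions are `mins`. -/
def SharesSecret (n : ℕ) (mins : List ℕ) (h : ℕ → ℝ) : Prop :=
  ∀ m < 2 ^ (n + 1), m % 2 = 1 →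
    h m = h (m - 1) + if mins.any fun b => b &&& (m - 1) == b then 0 else h 1

/-- The bound on `b` is essential, because `maskSet` does not see bits above `n`. -/
theorem maskSet_subset {n b m : ℕ} (hb : b < 2 ^ (n + 1)) :
    maskSet n b ⊆ maskSet n m ↔ b &&& m = b := by
  constructor
  · intro h
    apply Nat.eq_of_testBit_eq
    intro i
    rw [Nat.testBit_and]
    by_cases hi : b.testBit i
    · have hin : i < n + 1 := by
        by_contra hge
        rw [Nat.testBit_lt_two_pow (hb.trans_le (Nat.pow_le_pow_right two_pos (not_lt.1 hge)))] at hi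
        exact Bool.false_ne_true hi
      have hm : m.testBit i :=
        mem_maskSet.1 (h (show (⟨i, hin⟩ : Fin (n + 1)) ∈ maskSet n b from mem_maskSet.2 hi))
      simp [hi, hm]
    · simp [hi]
  · intro h i hi
    rw [mem_maskSet] at hi ⊢
    rw [← h, Nat.testBit_and, Bool.and_eq_true] at hi
    exact hi.2

/-- An odd mask `m` contains the secret and `m - 1` is its coalition of shares, so correctness and
security give the two cases. -/
theorem Scheme.sharesSecret {n : ℕ} {mins : List ℕ} (hmins : ∀ b ∈ mins, b < 2 ^ (n + 1))
    (σ : Scheme (.generatedBy ((mins.map (maskSet n)).toFinset) : AccessStructure n))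
    {h : ℕ → ℝ} (hh : ∀ m, h m = jointEntropy σ.law (maskSet n m)) :
    SharesSecret n mins h := by
  intro m _ hm
  have hone : maskSet n 1 = {0} := maskSet_two_pow (0 : Fin (n + 1))
  have h0 : (0 : Fin (n + 1)) ∉ maskSet n (m - 1) := by
    rw [mem_maskSet, Fin.val_zero, Nat.testBit_zero, decide_eq_true_eq]
    omega
  have hunion : maskSet n m = {0} ∪ maskSet n (m - 1) := by
    rw [← hone, ← maskSet_or]
    congr 1
    apply Nat.eq_of_testBit_eq
    intro i
    rw [Nat.testBit_or]
    cases i with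
    | zero => simp [hm]
    | succ i =>
      rw [Nat.testBit_add_one, Nat.testBit_add_one, Nat.testBit_add_one]
      have : (m - 1) / 2 = m / 2 := by omega
      simp [this]
  have hacc : maskSet n (m - 1) ∈ (AccessStructure.generatedBy
      ((mins.map (maskSet n)).toFinset) : AccessStructure n).accepted ↔
      (mins.any fun b => b &&& (m - 1) == b) = true := by
    rw [List.any_eq_true]
    change (_ ∧ ∃ B ∈ (mins.map (maskSet n)).toFinset, B ⊆ maskSet n (m - 1)) ↔ _
    simp only [List.mem_toFinset, List.mem_map, beq_iff_eq]
    constructor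
    · rintro ⟨_, _, ⟨b, hb, rfl⟩, hs⟩
      exact ⟨b, hb, (maskSet_subset (hmins b hb)).1 hs⟩
    · rintro ⟨b, hb, hs⟩
      exact ⟨h0, _, ⟨b, hb, rfl⟩, (maskSet_subset (hmins b hb)).2 hs⟩
  rw [hh m, hh (m - 1), hh 1, hunion, hone]
  by_cases hA : maskSet n (m - 1) ∈ (AccessStructure.generatedBy
      ((mins.map (maskSet n)).toFinset) : AccessStructure n).accepted
  · have := σ.correct _ hA
    rw [condEntropy] at this
    rw [if_pos (hacc.1 hA)]
    linarith
  · have := σ.secure _ ⟨h0, hA⟩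
    rw [condEntropy] at this
    rw [if_neg fun h => hA (hacc.2 h)]
    linarith

/-! ### Linear forms in the values of an entropy function -/

/-- A term `a * h m - b * h m`, given as the triple `(m, a, b)`; a list of terms is a linear form in
the values of `h`. -/
abbrev LinForm := List (ℕ × ℕ × ℕ)

namespace LinForm

/-- The value of a linear form. -/
def eval (h : ℕ → ℝ) (l : LinForm) : ℝ :=
  (l.map fun t => ((t.2.1 : ℝ) - t.2.2) * h t.1).sum

/-- The form `h m`. -/
def atom (m : ℕ) : LinForm := [(m, 1, 0)]

/-- The form multiplied by a natural number. -/
def smul (c : ℕ) (l : LinForm) : LinForm := l.map fun t => (t.1, c * t.2.1, c * t.2.2)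

/-- The negative of a form. -/
def neg (l : LinForm) : LinForm := l.map fun t => (t.1, t.2.2, t.2.1)

@[simp] theorem eval_nil (h : ℕ → ℝ) : eval h [] = 0 := rfl

@[simp] theorem eval_cons (h : ℕ → ℝ) (t : ℕ × ℕ × ℕ) (l : LinForm) :
    eval h (t :: l) = ((t.2.1 : ℝ) - t.2.2) * h t.1 + eval h l := rfl

@[simp] theorem eval_append (h : ℕ → ℝ) (l l' : LinForm) :
    eval h (l ++ l') = eval h l + eval h l' := by
  simp [eval]

@[simp] theorem eval_atom (h : ℕ → ℝ) (m : ℕ) : eval h (atom m) = h m := by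
  simp [atom]

@[simp] theorem eval_smul (h : ℕ → ℝ) (c : ℕ) (l : LinForm) :
    eval h (smul c l) = c * eval h l := by
  induction l with
  | nil => simp [smul]
  | cons t l ih =>
    rw [smul, List.map_cons, eval_cons, ← smul, ih, eval_cons]
    push_cast
    ring

@[simp] theorem eval_neg (h : ℕ → ℝ) (l : LinForm) : eval h (neg l) = -eval h l := by
  induction l with
  | nil => simp [neg]
  | cons t l ih =>
    rw [neg, List.map_cons, eval_cons, ← neg, ih, eval_cons]
    ring

/-! ### Deciding that a linear form vanishes -/

/-- The sum of `f t * b ^ m` over the terms `t` of a form, where `m` is the mask of `t` and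
`b = 2 ^ 24`: if all coefficients are less than `b`, then they can be read off. -/
def encode (f : ℕ × ℕ × ℕ → ℕ) : LinForm → ℕ
  | [] => 0
  | t :: l => f t <<< (24 * t.1) + encode f l

/-- The sum of `f t` over the terms `t`. -/
def total (f : ℕ × ℕ × ℕ → ℕ) : LinForm → ℕ
  | [] => 0
  | t :: l => f t + total f l

/-- The sum of `f t` over the terms `t` with mask `m`. -/
def coeff (f : ℕ × ℕ × ℕ → ℕ) (m : ℕ) : LinForm → ℕ
  | [] => 0
  | t :: l => (if t.1 = m then f t else 0) + coeff f m l

theorem coeff_le_total (f : ℕ × ℕ × ℕ → ℕ) (m : ℕ) (l : LinForm) :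
    coeff f m l ≤ total f l := by
  induction l with
  | nil => exact le_rfl
  | cons t l ih =>
    refine add_le_add ?_ ih
    split_ifs
    · exact le_rfl
    · exact Nat.zero_le _

theorem encode_eq_sum (f : ℕ × ℕ × ℕ → ℕ) {M : ℕ} {l : LinForm} (hl : ∀ t ∈ l, t.1 < M) :
    encode f l = ∑ m ∈ Finset.range M, coeff f m l * (2 ^ 24) ^ m := by
  induction l with
  | nil => simp [encode, coeff]
  | cons t l ih =>
    have ht : t.1 ∈ Finset.range M := Finset.mem_range.2 (hl t List.mem_cons_self)
    simp only [encode, coeff, add_mul, Finset.sum_add_distrib, ite_mul, zero_mul]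
    rw [Finset.sum_ite_eq, if_pos ht, ih fun t ht => hl t (List.mem_cons_of_mem _ ht),
      Nat.shiftLeft_eq, pow_mul]

theorem eval_eq_sum (h : ℕ → ℝ) {M : ℕ} {l : LinForm} (hl : ∀ t ∈ l, t.1 < M) :
    eval h l = ∑ m ∈ Finset.range M,
      ((coeff (·.2.1) m l : ℝ) - coeff (·.2.2) m l) * h m := by
  induction l with
  | nil => simp [coeff]
  | cons t l ih =>
    have ht : t.1 ∈ Finset.range M := Finset.mem_range.2 (hl t List.mem_cons_self)
    rw [eval_cons, ih fun t ht => hl t (List.mem_cons_of_mem _ ht)]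
    have e : ∀ m, ((coeff (·.2.1) m (t :: l) : ℝ) - coeff (·.2.2) m (t :: l)) * h m =
        (if t.1 = m then ((t.2.1 : ℝ) - t.2.2) * h m else 0) +
          ((coeff (·.2.1) m l : ℝ) - coeff (·.2.2) m l) * h m := by
      intro m
      simp only [coeff]
      split_ifs <;> push_cast <;> ring
    rw [Finset.sum_congr rfl fun m _ => e m, Finset.sum_add_distrib, Finset.sum_ite_eq, if_pos ht]

/-- Reduction modulo `b` recovers the lowest digit; cancel it, divide by `b` and repeat. -/
theorem digits_unique {b : ℕ} {f g : ℕ → ℕ} (hf : ∀ m, f m < b) (hg : ∀ m, g m < b) (M : ℕ)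
    (h : ∑ m ∈ Finset.range M, f m * b ^ m = ∑ m ∈ Finset.range M, g m * b ^ m) :
    ∀ m < M, f m = g m := by
  induction M generalizing f g with
  | zero => intro m hm; omega
  | succ M ih =>
    have hsplit : ∀ f : ℕ → ℕ, ∑ m ∈ Finset.range (M + 1), f m * b ^ m =
        f 0 + b * ∑ m ∈ Finset.range M, f (m + 1) * b ^ m := by
      intro f
      rw [Finset.sum_range_succ', Finset.mul_sum, pow_zero, mul_one, add_comm]
      congr 1
      exact Finset.sum_congr rfl fun m _ => by ring
    rw [hsplit f, hsplit g] at h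
    have hb : 0 < b := (Nat.zero_le _).trans_lt (hf 0)
    have h0 : f 0 = g 0 := by
      have := congrArg (· % b) h
      simpa [Nat.add_mul_mod_self_left, Nat.mod_eq_of_lt (hf 0), Nat.mod_eq_of_lt (hg 0)] using this
    rw [h0] at h
    have := ih (fun m => hf (m + 1)) (fun m => hg (m + 1))
      (Nat.eq_of_mul_eq_mul_left hb (Nat.add_left_cancel h))
    intro m hm
    cases m with
    | zero => exact h0
    | succ m => exact this m (by omega)

/-- A test which ensures that a form is zero. -/
def isZero (l : LinForm) : Bool :=
  -- The totals bound every collected coefficient, so no carries occur and the encodings determine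
  -- the coefficients.
  Nat.blt (total (·.2.1) l) (2 ^ 24) && Nat.blt (total (·.2.2) l) (2 ^ 24) &&
    Nat.beq (encode (·.2.1) l) (encode (·.2.2) l)

theorem eval_eq_zero {l : LinForm} (hl : l.isZero = true) (h : ℕ → ℝ) : eval h l = 0 := by
  simp only [isZero, Bool.and_eq_true, Nat.blt_eq, Nat.beq_eq] at hl
  obtain ⟨⟨h1, h2⟩, h3⟩ := hl
  obtain ⟨M, hM⟩ : ∃ M, ∀ t ∈ l, t.1 < M := by
    refine ⟨(l.map (·.1)).sum + 1, fun t ht => Nat.lt_succ_of_le ?_⟩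
    exact List.single_le_sum (fun _ _ => Nat.zero_le _) _ (List.mem_map_of_mem ht)
  rw [encode_eq_sum _ hM, encode_eq_sum _ hM] at h3
  have := digits_unique (fun m => (coeff_le_total _ m l).trans_lt h1)
    (fun m => (coeff_le_total _ m l).trans_lt h2) M h3
  rw [eval_eq_sum h hM]
  exact Finset.sum_eq_zero fun m hm => by rw [this m (Finset.mem_range.1 hm), sub_self, zero_mul]

end LinForm

/-- Rewrite `h m` by the copy steps (the last one first) and the accepted coalitions. -/
def normalForm (n : ℕ) (mins : List ℕ) : List CopyStep → ℕ → LinForm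
  | [], m =>
    -- The secrecy equation is stated for the original variables only; a mask that still contains
    -- copies stays an atom.
    bif Nat.blt m (2 ^ (n + 1)) && Nat.beq (m % 2) 1 then
      (bif Nat.beq m 1 then [] else LinForm.atom (m - 1)) ++
        bif mins.any fun b => b &&& (m - 1) == b then [] else LinForm.atom 1
    else bif Nat.beq m 0 then [] else LinForm.atom m
  | s :: ss, m =>
    bif Nat.blt m (2 ^ s.size) then normalForm n mins ss m
    else bif Nat.blt m (2 ^ (s.size + s.groups.length)) then
      -- If the old part lies in the base, the copies are replaced by their originals; if it
      -- contains the base, conditional independence splits the entropy. In the remaining case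
      -- neither copy equation applies.
      bif Nat.beq (m % 2 ^ s.size &&& s.base) (m % 2 ^ s.size) then
        normalForm n mins ss (m % 2 ^ s.size ||| mergedMask s.groups (m / 2 ^ s.size))
      else bif Nat.beq (m % 2 ^ s.size &&& s.base) s.base then
        normalForm n mins ss (m % 2 ^ s.size) ++
          (normalForm n mins ss (mergedMask s.groups (m / 2 ^ s.size) ||| s.base) ++
            (normalForm n mins ss s.base).neg)
      else LinForm.atom m
    else LinForm.atom m

/-- Every rewriting rule is an equation satisfied by `h`: a copy equation, the secrecy equation or
`h 0 = 0`. -/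
theorem eval_normalForm {n : ℕ} {mins : List ℕ} {h : ℕ → ℝ} (h0 : h 0 = 0)
    (hsec : SharesSecret n mins h) (ss : List CopyStep)
    (hss : ∀ s ∈ ss, IsCopy h s.size s.base s.groups) (m : ℕ) :
    (normalForm n mins ss m).eval h = h m := by
  induction ss generalizing m with
  | nil =>
    rw [normalForm]
    cases hc : Nat.blt m (2 ^ (n + 1)) && Nat.beq (m % 2) 1 with
    | true =>
      rw [Bool.and_eq_true, Nat.blt_eq, Nat.beq_eq] at hc
      rw [cond_true, LinForm.eval_append, hsec m hc.1 hc.2]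
      congr 1
      · cases h1 : Nat.beq m 1 with
        | true => simp [Nat.eq_of_beq_eq_true h1, h0]
        | false => simp
      · cases mins.any fun b => b &&& (m - 1) == b <;> simp
    | false =>
      cases h1 : Nat.beq m 0 with
      | true => simp [Nat.eq_of_beq_eq_true h1, h0]
      | false => simp
  | cons s ss ih =>
    have ih := ih fun s hs => hss s (List.mem_cons_of_mem _ hs)
    rw [normalForm]
    cases Nat.blt m (2 ^ s.size) with
    | true => exact ih m
    | false =>
      rw [cond_false]
      cases hlt : Nat.blt m (2 ^ (s.size + s.groups.length)) with
      | false => exact LinForm.eval_atom h m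
      | true =>
        rw [Nat.blt_eq] at hlt
        have hs := hss s List.mem_cons_self m hlt
        rw [cond_true]
        cases hu : Nat.beq (m % 2 ^ s.size &&& s.base) (m % 2 ^ s.size) with
        | true => rw [cond_true, ih, hs.1 (Nat.eq_of_beq_eq_true hu)]
        | false =>
          rw [cond_false]
          cases hC : Nat.beq (m % 2 ^ s.size &&& s.base) s.base with
          | false => exact LinForm.eval_atom h m
          | true =>
            rw [cond_true, LinForm.eval_append, LinForm.eval_append, LinForm.eval_neg, ih, ih, ih,
              hs.2 (Nat.eq_of_beq_eq_true hC)]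
            ring

/-! ### Certificates -/

/-- A certificate for a lower bound on a weighted sum of the entropies of the shares: the copy steps
(the last one first), the weights `w₁, w₂, …` of the shares, the multiple `total` of the entropy of
the secret, and a list of quadruples `(c, x, y, z)`, which stand for the nonnegative quantities
`c * I(x ; y | z)`. -/
structure Certificate where
  steps : List CopyStep
  weights : List ℕ
  total : ℕ
  rows : List (ℕ × ℕ × ℕ × ℕ)

/-- The number of variables with which a certificate works. -/
def Certificate.size (n : ℕ) (C : Certificate) : ℕ :=
  match C.steps with
  | [] => n + 1
  | s :: _ => s.size + s.groups.length

/-- The weighted sum of the normal forms of `h (2 ^ i), h (2 ^ (i + 1)), …`. -/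
def weightForm (N : ℕ → LinForm) : ℕ → List ℕ → LinForm
  | _, [] => []
  | i, w :: ws => (N (2 ^ i)).smul w ++ weightForm N (i + 1) ws

/-- The sum of the normal forms of the rows. -/
def rowForm (N : ℕ → LinForm) : List (ℕ × ℕ × ℕ × ℕ) → LinForm
  | [] => []
  | (c, x, y, z) :: rows =>
    (N (x ||| z) ++ (N (y ||| z) ++ ((N (x ||| y ||| z)).neg ++ (N z).neg))).smul c ++ rowForm N rows

/-- The test that a certificate is correct. -/
def Certificate.check (n : ℕ) (mins : List ℕ) (C : Certificate) : Bool :=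
  LinForm.isZero (rowForm (normalForm n mins C.steps) C.rows ++ ([(1, C.total, 0)] ++
    (weightForm (normalForm n mins C.steps) 1 C.weights).neg))

theorem eval_weightForm {N : ℕ → LinForm} {h : ℕ → ℝ} (hN : ∀ m, (N m).eval h = h m)
    (i : ℕ) (ws : List ℕ) :
    (weightForm N i ws).eval h = ∑ j : Fin ws.length, (ws[j] : ℝ) * h (2 ^ (i + (j : ℕ))) := by
  induction ws generalizing i with
  | nil => simp [weightForm]
  | cons w ws ih =>
    rw [weightForm, LinForm.eval_append, LinForm.eval_smul, hN, ih]
    simp only [List.length_cons]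
    rw [Fin.sum_univ_succ]
    simp [add_assoc, add_comm 1]

/-- Each row is a multiple of an instance of submodularity. Rows with `x = y` are conditional
entropies, so monotonicity is covered as well. -/
theorem eval_rowForm_nonneg {N : ℕ → LinForm} {h : ℕ → ℝ} (hh : IsEntropic h)
    (hN : ∀ m, (N m).eval h = h m) (rows : List (ℕ × ℕ × ℕ × ℕ)) :
    0 ≤ (rowForm N rows).eval h := by
  induction rows with
  | nil => exact le_rfl
  | cons r rows ih =>
    obtain ⟨c, x, y, z⟩ := r
    rw [rowForm]
    simp only [LinForm.eval_append, LinForm.eval_smul, LinForm.eval_neg, hN]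
    have := hh.submodular x y z
    exact add_nonneg (mul_nonneg c.cast_nonneg (by linarith)) ih

/-- The test says that the rows plus `total * h 1` equal the weighted share entropies identically
after normalisation, and the rows are nonnegative. -/
theorem Certificate.total_mul_le {n : ℕ} {mins : List ℕ} {C : Certificate}
    (hC : C.check n mins = true) {h : ℕ → ℝ} (hh : IsEntropic h) (hsec : SharesSecret n mins h)
    (hss : ∀ s ∈ C.steps, IsCopy h s.size s.base s.groups) :
    C.total * h 1 ≤ ∑ j : Fin C.weights.length, (C.weights[j] : ℝ) * h (2 ^ (1 + (j : ℕ))) := by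
  have hN := eval_normalForm hh.map_zero hsec C.steps hss
  have h1 := LinForm.eval_eq_zero hC h
  rw [LinForm.eval_append, LinForm.eval_append, LinForm.eval_neg, eval_weightForm hN] at h1
  have h2 := eval_rowForm_nonneg hh hN C.rows
  simp only [LinForm.eval_cons, LinForm.eval_nil, Nat.cast_zero, sub_zero, add_zero] at h1
  linarith

/-- A correct certificate bounds the information ratio of an access structure from below. -/
theorem Certificate.le_informationRatio {n : ℕ} {mins : List ℕ} {C : Certificate}
    (hmins : ∀ b ∈ mins, b < 2 ^ (n + 1)) (hw : C.weights.length = n)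
    (hsteps : CopyStep.WellFormed (n + 1) C.steps (C.size n)) (hC : C.check n mins = true)
    {r : ℝ} (hr : r * (C.weights.sum : ℕ) ≤ C.total)
    (hpos : 0 < C.weights.sum) :
    (r : EReal) ≤
      (AccessStructure.generatedBy ((mins.map (maskSet n)).toFinset) :
        AccessStructure n).informationRatio := by
  refine le_iInf fun σ => EReal.coe_le_coe_iff.2 ?_
  obtain ⟨h₀, hh₀, hlaw⟩ := exists_isEntropic σ.law
  obtain ⟨h, hh, hlow, hss⟩ := hh₀.exists_copies hsteps
  have hsec : SharesSecret n mins h := by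
    intro m hm hodd
    have := σ.sharesSecret hmins hlaw m hm hodd
    rwa [← hlow m hm, ← hlow (m - 1) (by omega), ← hlow 1 (Nat.one_lt_two_pow (by omega))] at this
  have hle := C.total_mul_le hC hh hsec hss
  have hone : h 1 = jointEntropy σ.law {0} := by
    rw [hlow 1 (Nat.one_lt_two_pow (by omega)), hlaw]
    exact congrArg _ (maskSet_two_pow (0 : Fin (n + 1)))
  have hshare : ∀ j : Fin C.weights.length,
      h (2 ^ (1 + (j : ℕ))) = jointEntropy σ.law {(Fin.cast hw j).succ} := by
    intro j
    have hj : 1 + (j : ℕ) < n + 1 := by omega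
    rw [hlow _ (Nat.pow_lt_pow_right one_lt_two hj), hlaw, ← maskSet_two_pow]
    simp [add_comm]
  have hsecret : 0 < h 1 := hone ▸ σ.secret_pos
  have hbdd : ∀ j : Fin C.weights.length,
      h (2 ^ (1 + (j : ℕ))) ≤ σ.informationRatio * h 1 := by
    intro j
    rw [hshare, hone, ← div_le_iff₀ σ.secret_pos]
    exact le_ciSup (f := fun i : Fin n =>
      jointEntropy σ.law {i.succ} / jointEntropy σ.law {0}) (Set.finite_range _).bddAbove
      (Fin.cast hw j)
  have hsum : ∑ j : Fin C.weights.length, (C.weights[j] : ℝ) * h (2 ^ (1 + (j : ℕ))) ≤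
      ∑ j : Fin C.weights.length, (C.weights[j] : ℝ) * (σ.informationRatio * h 1) :=
    Finset.sum_le_sum fun j _ => mul_le_mul_of_nonneg_left (hbdd j) (Nat.cast_nonneg _)
  have hweights : ∑ j : Fin C.weights.length, (C.weights[j] : ℝ) =
      (C.weights.sum : ℕ) := by
    rw [Nat.cast_list_sum, ← Fin.sum_univ_fun_getElem]
    rfl
  rw [← Finset.sum_mul, hweights] at hsum
  have hW : (0 : ℝ) < (C.weights.sum : ℕ) := Nat.cast_pos.2 hpos
  -- With `W` the sum of the weights, this is `r * W * h 1 ≤ W * (ratio * h 1)`; the positive factor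
  -- `W * h 1` cancels.
  have := (mul_le_mul_of_nonneg_right hr hsecret.le).trans (hle.trans hsum)
  by_contra hlt
  have h3 := mul_lt_mul_of_pos_right (not_le.1 hlt) (mul_pos hW hsecret)
  nlinarith

/-! ### The seven access structures -/

/-- The bit masks of the minimal accepted coalitions of `𝒜`. -/
def minsA : List ℕ := [14, 50, 194, 84, 164, 152, 104, 150]

theorem accessA_eq : accessA = .generatedBy ((minsA.map (maskSet 7)).toFinset) := by
  unfold accessA
  congr 1

/-- A certificate for the lower bound `57/50` on the information ratio of `𝒜`. -/
def certificateA : Certificate where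
  -- Over the forbidden coalition `1256`, the secret and shares 3, 4, 7 are copied to indices 8 to
  -- 11. Then 1 and 2, merged, are copied over indices 0, 3, 5, 6, 8, 9.
  steps := [⟨12, 873, [6]⟩, ⟨8, 102, [1, 8, 16, 128]⟩]
  weights := [7, 7, 72, 5, 0, 0, 9]
  total := 114
  rows := [(7, 2, 4, 0), (7, 8, 16, 0), (15, 8, 32, 0), (13, 8, 128, 0), (29, 8, 512, 0),
     (7, 8, 1024, 0), (22, 8, 4096, 0), (9, 8, 1024, 6), (4, 128, 4096, 6), (1, 2048, 4096, 6),
     (14, 16, 128, 8), (7, 256, 1024, 9), (14, 1, 526, 14), (7, 1, 1038, 14), (2, 1024, 4096, 14),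
     (15, 8, 64, 32), (7, 4, 16, 96), (1, 4, 4096, 96), (4, 128, 4096, 96), (3, 1024, 4096, 96),
     (7, 2, 16, 100), (1, 2, 4096, 100), (58, 8, 128, 103), (15, 1, 616, 104), (7, 1, 3176, 104),
     (7, 2, 8, 113), (7, 2, 128, 120), (4, 8, 4096, 128), (1, 16, 64, 135), (4, 64, 4096, 135),
     (4, 16, 4096, 137), (4, 1, 4246, 150), (5, 16, 32, 198), (4, 32, 4096, 214),
     (4, 16, 4096, 224), (63, 8, 16, 230), (4, 4, 8, 242), (7, 4, 1024, 242), (2, 2, 4096, 248),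
     (2, 512, 4096, 248), (2, 4, 4096, 250), (7, 512, 1024, 265), (15, 8, 64, 512),
     (14, 8, 4096, 512), (14, 256, 527, 518), (15, 8, 32, 576), (15, 256, 617, 608),
     (7, 256, 3688, 608), (7, 256, 3816, 608), (2, 8, 4096, 630), (2, 8, 4096, 758), (2, 1, 1, 760),
     (2, 256, 256, 761), (7, 2, 4096, 777), (7, 4, 4096, 779), (7, 8, 64, 1024),
     (2, 512, 4096, 1024), (7, 2, 2048, 1033), (7, 4, 2048, 1035), (3, 256, 3178, 1058),
     (9, 8, 64, 1062), (9, 256, 256, 1070), (7, 8, 32, 1088), (9, 256, 1102, 1092),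
     (9, 32, 2048, 1102), (7, 8, 2048, 1120), (3, 2048, 4096, 1120), (4, 4, 8, 1122),
     (3, 4, 4096, 1122), (4, 4, 2048, 1130), (7, 512, 2048, 1266), (9, 8, 32, 1286),
     (9, 64, 2048, 1294), (7, 4, 2048, 1778), (7, 1, 2048, 1792), (2, 2048, 4096, 1792),
     (7, 8, 2048, 1793), (1, 1024, 4096, 2816), (1, 32, 4096, 3078), (9, 256, 3086, 3078),
     (7, 32, 512, 3081), (7, 1, 1, 3086), (2, 64, 4096, 3086), (1, 64, 4096, 3110),
     (7, 64, 512, 3113), (2, 32, 4096, 3150), (9, 256, 256, 3150), (3, 2, 8, 3172),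
     (1, 512, 4096, 3174), (5, 4, 512, 3178), (2, 512, 4096, 3178), (3, 256, 256, 3180),
     (7, 4, 8, 3314), (7, 4, 512, 3322), (4, 2, 8, 3424), (7, 2, 128, 3424), (3, 4, 8, 3424),
     (7, 2, 512, 3432), (7, 2, 8, 3552), (7, 2, 512, 3560), (7, 256, 256, 3593), (3, 2, 4096, 3680),
     (7, 1, 1, 3688), (7, 256, 256, 3690), (7, 2, 4, 3816), (7, 256, 256, 3818), (7, 2, 16, 3820),
     (72, 8, 4096, 3830), (7, 1, 1, 3834), (7, 256, 256, 3835), (7, 1, 1, 3836),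
     (7, 256, 256, 3837), (1, 512, 2048, 4096), (4, 16, 512, 4102), (1, 64, 512, 4102),
     (4, 1, 4232, 4104), (1, 1, 4974, 4104), (2, 1, 5112, 4104), (6, 1, 5118, 4104),
     (6, 1, 8046, 4104), (72, 1, 8190, 4104), (2, 32, 512, 4110), (4, 32, 512, 4118),
     (2, 16, 512, 4142), (4, 128, 512, 4150), (2, 64, 512, 4158), (1, 32, 512, 4166),
     (2, 128, 512, 4222), (4, 2, 16, 4224), (4, 4, 16, 4226), (4, 16, 64, 4231), (4, 8, 32, 4240),
     (4, 1, 1, 4248), (4, 8, 64, 4272), (4, 64, 512, 4278), (4, 1, 1, 4310), (1, 256, 4718, 4608),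
     (2, 256, 4856, 4608), (6, 256, 4862, 4608), (2, 256, 5632, 4608), (1, 256, 6656, 4608),
     (6, 256, 7790, 4608), (72, 256, 7934, 4608), (1, 8, 32, 4614), (4, 8, 2048, 4614),
     (7, 1, 1, 4622), (7, 256, 256, 4623), (1, 8, 64, 4646), (2, 8, 128, 4726), (2, 8, 2048, 5120),
     (2, 2, 2048, 5128), (2, 4, 2048, 5130), (3, 4, 512, 5218), (3, 4, 2048, 5730),
     (1, 2, 1024, 6144), (1, 4, 1024, 6146), (4, 8, 1024, 6662), (3, 32, 512, 7168),
     (3, 64, 512, 7200), (2, 4, 512, 7274), (3, 256, 256, 7680), (4, 8, 32, 7686), (4, 8, 64, 7718),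
     (72, 1, 1, 7926), (72, 256, 256, 7927), (9, 128, 128, 8063), (5, 16, 16, 8175),
     (72, 8, 8, 8183), (7, 4, 4, 8187), (7, 2, 2, 8189)]

theorem le_informationRatio_accessA : ((57 / 50 : ℝ) : EReal) ≤ accessA.informationRatio := by
  rw [accessA_eq]
  exact certificateA.le_informationRatio (by decide) rfl (by decide)
    -- The weights sum to `100`, and `114 / 100 = 57 / 50`.
    (by decide +kernel) (by change (57 / 50 : ℝ) * (100 : ℕ) ≤ (114 : ℕ); norm_num) (by decide)

/-- The bit masks of the minimal accepted coalitions of `𝒜*`. -/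
def minsAStar : List ℕ := [14, 50, 194, 84, 164, 152, 106, 108, 120, 232]

theorem accessAStar_eq : accessAStar = .generatedBy ((minsAStar.map (maskSet 7)).toFinset) := by
  unfold accessAStar
  congr 1

/-- A certificate for the lower bound `52/45` on the information ratio of `𝒜*`. -/
def certificateAStar : Certificate where
  -- A single step: the secret and shares 3, 5, 6 are copied over the forbidden coalition `1247`.
  steps := [⟨8, 150, [1, 8, 32, 64]⟩]
  weights := [11, 17, 18, 10, 12, 12, 10]
  total := 104
  rows := [(14, 2, 8, 0), (4, 2, 128, 0), (9, 4, 8, 0), (4, 4, 64, 0), (4, 4, 128, 0),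
     (4, 8, 16, 0), (8, 16, 32, 0), (8, 16, 64, 0), (2, 16, 128, 0), (5, 32, 512, 0),
     (4, 32, 1024, 0), (12, 32, 2048, 0), (4, 2, 2048, 1), (2, 4, 8, 2), (4, 8, 512, 2),
     (1, 32, 512, 2), (4, 64, 128, 2), (2, 64, 1024, 6), (2, 2, 4, 8), (7, 4, 32, 8),
     (4, 1, 526, 14), (3, 1, 574, 14), (1, 1, 622, 14), (9, 1, 1646, 14), (4, 32, 512, 16),
     (4, 64, 512, 16), (4, 64, 2048, 16), (1, 2, 64, 32), (4, 4, 2048, 32), (4, 8, 2048, 32),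
     (4, 64, 2048, 33), (6, 4, 512, 34), (4, 16, 2048, 36), (6, 64, 512, 38), (4, 2, 2048, 40),
     (7, 4, 64, 40), (4, 128, 2048, 42), (4, 1, 1074, 50), (2, 1, 1210, 50), (2, 1, 1654, 50),
     (4, 1, 2610, 50), (2, 1, 3190, 50), (4, 8, 2048, 52), (1, 2, 64, 61), (3, 128, 512, 61),
     (1, 128, 2048, 62), (4, 4, 16, 64), (4, 128, 2048, 67), (2, 32, 1024, 70), (4, 32, 512, 80),
     (10, 1, 756, 84), (3, 1, 1660, 84), (4, 1, 2132, 84), (1, 2, 8, 96), (4, 8, 256, 96),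
     (2, 16, 512, 96), (2, 16, 512, 103), (8, 128, 1024, 103), (3, 2, 256, 105), (3, 4, 2048, 105),
     (2, 128, 512, 105), (1, 4, 256, 106), (1, 128, 512, 106), (1, 16, 2048, 110),
     (6, 128, 512, 112), (2, 128, 512, 118), (1, 4, 128, 120), (1, 4, 1024, 120), (3, 2, 2048, 124),
     (3, 128, 2048, 126), (4, 4, 32, 128), (4, 8, 16, 128), (2, 32, 2048, 144), (18, 8, 64, 151),
     (24, 32, 64, 151), (10, 1, 760, 152), (4, 1, 920, 152), (3, 1, 1724, 152), (2, 1, 742, 164),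
     (4, 1, 1444, 164), (6, 1, 1766, 164), (4, 1, 2724, 164), (6, 1, 3302, 164), (1, 4, 512, 171),
     (3, 4, 1024, 171), (1, 16, 1024, 174), (3, 16, 2048, 174), (2, 64, 2048, 176),
     (3, 2, 512, 188), (1, 1, 746, 194), (1, 1, 1258, 194), (1, 1, 3306, 194), (26, 8, 32, 214),
     (2, 2, 32, 220), (8, 16, 1024, 230), (1, 4, 1024, 232), (1, 16, 1024, 232), (1, 4, 2048, 234),
     (1, 2, 1024, 236), (2, 16, 512, 238), (10, 2, 512, 241), (10, 4, 512, 242), (1, 2, 1024, 252),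
     (4, 8, 128, 256), (4, 32, 128, 256), (4, 128, 512, 264), (4, 128, 1024, 288), (4, 8, 512, 352),
     (2, 2, 512, 361), (1, 2, 2048, 361), (1, 4, 512, 362), (5, 2, 32, 512), (4, 4, 8, 514),
     (4, 256, 527, 518), (6, 256, 614, 518), (4, 2, 32, 528), (4, 32, 2048, 530), (3, 2, 1024, 573),
     (3, 128, 1024, 574), (2, 256, 1024, 608), (1, 8, 128, 615), (1, 128, 1024, 615),
     (2, 128, 256, 617), (1, 4, 256, 618), (2, 256, 256, 622), (2, 1, 1, 630), (6, 256, 752, 656),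
     (4, 256, 1788, 656), (1, 4, 64, 683), (3, 1, 1, 700), (2, 256, 256, 742), (2, 1, 1, 750),
     (10, 4, 8, 753), (10, 1, 1, 754), (4, 2, 8, 756), (2, 2, 2048, 756), (4, 256, 256, 756),
     (8, 4, 1024, 760), (2, 256, 256, 760), (10, 1, 1, 764), (2, 2, 1024, 764), (4, 1, 32, 776),
     (4, 2, 128, 777), (4, 4, 16, 779), (4, 4, 128, 795), (4, 1, 64, 808), (4, 4, 16, 864),
     (2, 4, 128, 864), (2, 2, 128, 868), (4, 2, 1024, 868), (2, 1, 1, 874), (4, 4, 128, 880),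
     (4, 8, 16, 896), (4, 2, 16, 905), (2, 8, 16, 992), (2, 1, 1, 1000), (4, 2, 32, 1024),
     (4, 16, 32, 1024), (2, 64, 2048, 1030), (4, 256, 1075, 1042), (4, 256, 3674, 1042),
     (4, 2, 16, 1056), (2, 32, 2048, 1094), (8, 512, 2048, 1127), (1, 4, 128, 1144),
     (4, 256, 3748, 1156), (1, 4, 16, 1195), (1, 4, 64, 1195), (1, 16, 2048, 1195), (1, 1, 1, 1198),
     (2, 4, 64, 1210), (8, 1, 1, 1254), (2, 2, 512, 1256), (2, 4, 512, 1258), (1, 16, 2048, 1258),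
     (1, 1, 1, 1262), (3, 4, 2048, 1274), (4, 1, 2048, 1312), (4, 4, 16, 1313), (4, 16, 128, 1317),
     (4, 2, 128, 1329), (4, 4, 32, 1408), (4, 2, 4, 1457), (3, 64, 128, 1597), (3, 1, 1, 1598),
     (2, 256, 2048, 1632), (2, 8, 16, 1639), (7, 8, 128, 1639), (9, 16, 128, 1646),
     (2, 128, 2048, 1654), (3, 2, 128, 1660), (2, 1, 1, 1662), (10, 128, 2048, 1662),
     (3, 2, 2048, 1724), (6, 16, 2048, 1766), (2, 16, 2048, 1768), (7, 1, 1, 1774),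
     (10, 4, 2048, 1784), (3, 1, 1, 1788), (8, 2, 2048, 1788), (4, 2, 8, 1892), (4, 2, 16, 1900),
     (4, 2, 128, 1916), (4, 32, 128, 2048), (4, 2, 64, 2049), (4, 4, 64, 2064),
     (4, 256, 2108, 2068), (4, 256, 2133, 2068), (4, 512, 1024, 2081), (1, 256, 256, 2110),
     (4, 32, 256, 2113), (3, 4, 256, 2153), (1, 16, 128, 2158), (3, 256, 256, 2172),
     (4, 32, 512, 2176), (4, 256, 2218, 2178), (4, 256, 2243, 2178), (2, 32, 1024, 2192),
     (3, 256, 256, 2222), (2, 64, 1024, 2224), (1, 256, 256, 2282), (4, 32, 1024, 2304),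
     (4, 8, 64, 2336), (1, 2, 16, 2344), (3, 4, 128, 2344), (1, 64, 128, 2346), (3, 16, 64, 2348),
     (1, 2, 4, 2360), (4, 4, 128, 2369), (4, 16, 128, 2373), (4, 1, 8, 2400), (1, 1, 1, 2410),
     (3, 1, 1, 2412), (3, 2, 4, 2472), (4, 2, 4, 2497), (4, 2, 16, 2501), (4, 32, 128, 2582),
     (4, 2, 4, 2593), (4, 4, 16, 2595), (4, 128, 1024, 2597), (4, 1, 1, 2614), (4, 4, 32, 2688),
     (2, 2, 32, 2708), (2, 2, 1024, 2740), (2, 2, 1024, 2804), (4, 4, 64, 2834), (4, 4, 8, 2898),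
     (4, 4, 1024, 2906), (4, 16, 32, 2948), (4, 16, 1024, 2980), (2, 64, 512, 3072),
     (4, 256, 512, 3105), (2, 32, 512, 3136), (2, 4, 16, 3168), (2, 2, 16, 3172),
     (2, 16, 512, 3175), (6, 128, 512, 3175), (2, 128, 512, 3184), (1, 16, 64, 3243),
     (6, 8, 16, 3302), (2, 4, 16, 3306), (8, 16, 512, 3310), (1, 1, 1, 3322), (3, 4, 512, 3322),
     (4, 256, 256, 3621), (4, 4, 32, 3674), (4, 256, 256, 3678), (2, 256, 256, 3696),
     (2, 1, 1, 3702), (4, 4, 128, 3706), (10, 1, 1, 3710), (10, 256, 256, 3711), (2, 2, 32, 3728),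
     (2, 4, 32, 3730), (4, 1, 1, 3748), (2, 4, 64, 3760), (4, 256, 256, 3764), (3, 2, 64, 3772),
     (6, 1, 1, 3814), (2, 2, 16, 3816), (2, 4, 16, 3818), (10, 1, 1, 3822), (10, 256, 256, 3823),
     (10, 2, 4, 3832), (17, 1, 1, 3834), (17, 256, 256, 3835), (11, 1, 1, 3836),
     (11, 256, 256, 3837), (4, 1, 4, 3840), (2, 16, 64, 3840), (4, 4, 32, 3841), (2, 16, 32, 3904),
     (10, 128, 128, 3967), (12, 64, 64, 4031), (12, 32, 32, 4063), (10, 16, 16, 4079),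
     (18, 8, 8, 4087), (17, 4, 4, 4091), (11, 2, 2, 4093)]

theorem le_informationRatio_accessAStar : ((52 / 45 : ℝ) : EReal) ≤ accessAStar.informationRatio := by
  rw [accessAStar_eq]
  exact certificateAStar.le_informationRatio (by decide) rfl (by decide)
    (by decide +kernel) (by change (52 / 45 : ℝ) * (90 : ℕ) ≤ (104 : ℕ); norm_num) (by decide)

/-- The bit masks of the minimal accepted coalitions of `ℱ`. -/
def minsF : List ℕ := [14, 50, 194, 84, 164, 152, 104, 150, 102]

theorem accessF_eq : accessF = .generatedBy ((minsF.map (maskSet 7)).toFinset) := by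
  unfold accessF
  congr 1

/-- A certificate for the lower bound `17/15` on the information ratio of `ℱ`. -/
def certificateF : Certificate where
  -- The secret merged with share 5 is copied over the forbidden `2367`, then 3 merged with 6 over
  -- indices 0, 2, 5, 7, 8.
  steps := [⟨9, 421, [72]⟩, ⟨8, 204, [33]⟩]
  weights := [1, 0, 1, 1, 11, 1, 0]
  total := 17
  rows := [(2, 2, 16, 0), (2, 2, 32, 0), (1, 8, 64, 0), (6, 32, 128, 0), (4, 32, 512, 0),
     (2, 16, 32, 2), (1, 32, 512, 2), (1, 32, 256, 16), (1, 16, 512, 35), (1, 2, 256, 49),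
     (1, 2, 256, 72), (1, 2, 512, 72), (1, 32, 256, 72), (2, 16, 256, 74), (1, 4, 512, 91),
     (1, 32, 128, 91), (1, 128, 512, 94), (2, 1, 360, 104), (1, 128, 256, 122), (6, 4, 32, 128),
     (1, 2, 512, 132), (1, 16, 64, 132), (1, 16, 256, 132), (3, 32, 256, 132), (1, 16, 32, 135),
     (2, 64, 256, 149), (2, 1, 406, 150), (1, 256, 512, 150), (2, 1, 412, 152), (1, 1, 730, 152),
     (3, 1, 420, 164), (1, 8, 16, 166), (1, 16, 64, 174), (1, 8, 256, 197), (9, 16, 32, 205),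
     (1, 8, 256, 212), (1, 4, 32, 218), (1, 4, 256, 250), (1, 32, 512, 256), (1, 2, 4, 272),
     (1, 8, 32, 274), (1, 2, 128, 276), (1, 32, 64, 282), (1, 1, 16, 288), (1, 64, 512, 289),
     (1, 1, 1, 306), (1, 16, 512, 330), (1, 8, 512, 353), (1, 8, 512, 388), (1, 64, 512, 396),
     (2, 2, 8, 405), (2, 32, 512, 406), (2, 2, 64, 412), (2, 1, 1, 414), (1, 1, 1, 438),
     (1, 8, 64, 438), (1, 1, 1, 446), (1, 8, 16, 453), (1, 1, 1, 468), (10, 32, 512, 476),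
     (1, 1, 1, 502), (1, 4, 16, 514), (1, 16, 128, 518), (1, 32, 64, 530), (1, 1, 546, 544),
     (1, 1, 634, 544), (1, 1, 950, 544), (1, 1, 1004, 544), (12, 1, 1022, 544), (1, 1, 1, 562),
     (1, 2, 256, 584), (1, 8, 32, 594), (1, 128, 256, 602), (1, 32, 128, 603), (1, 1, 1, 606),
     (1, 4, 32, 730), (1, 32, 256, 730), (1, 1, 1, 762), (1, 4, 256, 762), (1, 4, 32, 840),
     (1, 32, 128, 844), (1, 1, 1, 872), (1, 8, 32, 918), (1, 32, 64, 926), (1, 64, 64, 959),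
     (10, 2, 32, 988), (11, 1, 1, 990), (11, 32, 32, 991), (1, 16, 16, 1007), (1, 8, 8, 1015),
     (1, 2, 2, 1021)]

theorem le_informationRatio_accessF : ((17 / 15 : ℝ) : EReal) ≤ accessF.informationRatio := by
  rw [accessF_eq]
  exact certificateF.le_informationRatio (by decide) rfl (by decide)
    (by decide +kernel) (by change (17 / 15 : ℝ) * (15 : ℕ) ≤ (17 : ℕ); norm_num) (by decide)

/-- The bit masks of the minimal accepted coalitions of `ℱ*`. -/
def minsFStar : List ℕ := [14, 50, 194, 84, 164, 154, 106, 156, 108, 120, 184, 216, 232]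

theorem accessFStar_eq : accessFStar = .generatedBy ((minsFStar.map (maskSet 7)).toFinset) := by
  unfold accessFStar
  congr 1

/-- A certificate for the lower bound `8/7` on the information ratio of `ℱ*`. -/
def certificateFStar : Certificate where
  -- Shares 1 and 4, merged, are copied over indices 0, 2, 5, 7; then the secret merged with 7 over
  -- the forbidden `1256`.
  steps := [⟨9, 102, [129]⟩, ⟨8, 165, [18]⟩]
  weights := [2, 2, 0, 0, 5, 0, 5]
  total := 16
  rows := [(1, 2, 16, 0), (2, 2, 128, 0), (4, 4, 32, 0), (1, 8, 128, 0), (1, 16, 256, 0),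
     (4, 32, 128, 0), (1, 32, 256, 0), (1, 64, 128, 2), (2, 32, 128, 4), (1, 64, 128, 8),
     (1, 32, 256, 16), (1, 128, 512, 16), (1, 8, 256, 18), (1, 64, 256, 26), (3, 4, 128, 32),
     (1, 128, 512, 32), (1, 16, 512, 36), (1, 2, 256, 49), (1, 8, 512, 52), (1, 2, 512, 61),
     (1, 128, 256, 62), (1, 16, 512, 66), (1, 32, 256, 72), (1, 8, 512, 82), (1, 1, 636, 84),
     (2, 32, 128, 91), (3, 16, 128, 103), (1, 128, 256, 105), (3, 8, 128, 118), (2, 4, 128, 122),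
     (4, 128, 256, 126), (1, 2, 64, 128), (1, 2, 256, 132), (1, 8, 256, 132), (1, 16, 256, 134),
     (1, 64, 256, 140), (1, 8, 32, 144), (3, 32, 64, 151), (1, 64, 512, 153), (1, 1, 676, 164),
     (1, 4, 8, 177), (1, 2, 8, 180), (1, 8, 32, 192), (1, 1, 706, 194), (1, 2, 16, 205),
     (1, 32, 256, 206), (3, 32, 256, 214), (1, 4, 32, 216), (2, 4, 512, 218), (2, 32, 512, 220),
     (1, 32, 512, 222), (1, 4, 256, 225), (1, 2, 8, 228), (1, 4, 256, 248), (1, 4, 32, 274),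
     (1, 32, 128, 278), (1, 1, 304, 288), (1, 1, 360, 288), (1, 1, 438, 288), (1, 1, 480, 288),
     (1, 1, 492, 288), (2, 1, 508, 288), (13, 1, 510, 288), (1, 1, 1, 306), (1, 64, 128, 318),
     (1, 2, 4, 328), (1, 16, 128, 330), (1, 2, 128, 332), (5, 1, 1, 382), (1, 16, 32, 458),
     (3, 32, 512, 470), (1, 4, 8, 480), (1, 1, 1, 484), (1, 1, 1, 488), (1, 4, 512, 490),
     (1, 2, 512, 504), (1, 2, 512, 508), (1, 2, 128, 512), (1, 64, 128, 514), (1, 8, 128, 528),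
     (1, 4, 64, 536), (1, 32, 64, 540), (1, 4, 128, 544), (1, 2, 64, 573), (1, 2, 128, 600),
     (1, 1, 16, 640), (1, 2, 4, 641), (1, 4, 64, 643), (1, 32, 64, 645), (1, 1, 8, 656),
     (1, 2, 32, 709), (1, 1, 1, 728), (1, 4, 256, 730), (2, 32, 256, 732), (5, 128, 128, 895),
     (3, 8, 32, 982), (1, 4, 32, 986), (2, 2, 32, 988), (5, 1, 1, 990), (5, 32, 32, 991),
     (1, 4, 16, 1002), (1, 2, 4, 1016), (2, 1, 1, 1018), (2, 4, 4, 1019), (2, 1, 1, 1020),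
     (2, 2, 2, 1021)]

theorem le_informationRatio_accessFStar : ((8 / 7 : ℝ) : EReal) ≤ accessFStar.informationRatio := by
  rw [accessFStar_eq]
  exact certificateFStar.le_informationRatio (by decide) rfl (by decide)
    (by decide +kernel) (by change (8 / 7 : ℝ) * (14 : ℕ) ≤ (16 : ℕ); norm_num) (by decide)

/-- The bit masks of the minimal accepted coalitions of `ℱ̂`. -/
def minsFHat : List ℕ := [14, 50, 194, 84, 164, 152, 102, 106, 108, 120, 232]

theorem accessFHat_eq : accessFHat = .generatedBy ((minsFHat.map (maskSet 7)).toFinset) := by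
  unfold accessFHat
  congr 1

/-- A certificate for the lower bound `23/20` on the information ratio of `ℱ̂`. -/
def certificateFHat : Certificate where
  -- Over the forbidden `1247`, the secret merged with 5 and the pair 3, 5 are copied jointly; then
  -- the pair 3, 4 over indices 0, 1, 6, 7, and the pair 3, 7 over indices 0, 2, 4, 6.
  steps := [⟨11, 85, [136]⟩, ⟨10, 195, [24]⟩, ⟨8, 150, [33, 40]⟩]
  weights := [26, 74, 0, 174, 200, 60, 86]
  total := 713
  rows := [(40, 2, 16, 0), (147, 2, 32, 0), (6, 2, 64, 0), (61, 4, 16, 0), (47, 4, 64, 0),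
     (46, 4, 128, 0), (27, 4, 512, 0), (33, 8, 128, 0), (27, 8, 2048, 0), (13, 16, 512, 0),
     (6, 16, 1024, 0), (60, 16, 2048, 0), (93, 32, 128, 0), (7, 64, 2048, 0), (7, 128, 512, 0),
     (107, 16, 32, 2), (40, 32, 256, 2), (20, 64, 128, 2), (81, 16, 64, 4), (20, 64, 512, 4),
     (6, 128, 1024, 4), (27, 4, 64, 8), (27, 16, 2048, 8), (6, 32, 256, 8), (27, 32, 64, 12),
     (60, 1, 430, 14), (6, 1, 1102, 14), (6, 128, 1024, 16), (40, 8, 256, 18), (27, 32, 2048, 19),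
     (20, 32, 512, 20), (6, 4, 1024, 24), (27, 128, 2048, 25), (40, 64, 256, 26), (6, 32, 1024, 28),
     (13, 16, 64, 40), (20, 64, 512, 40), (40, 1, 306, 50), (20, 8, 512, 52), (6, 2, 128, 61),
     (53, 2, 256, 61), (7, 2, 512, 61), (13, 128, 512, 62), (6, 4, 1024, 66), (6, 8, 1024, 66),
     (2, 128, 1024, 66), (27, 2, 2048, 68), (27, 128, 2048, 68), (27, 8, 32, 71),
     (6, 128, 1024, 71), (27, 32, 256, 72), (6, 16, 1024, 74), (27, 32, 128, 78), (33, 1, 380, 84),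
     (13, 1, 476, 84), (20, 1, 596, 84), (60, 4, 128, 91), (60, 128, 256, 94), (6, 1, 1126, 102),
     (27, 16, 2048, 102), (13, 2, 512, 105), (27, 4, 256, 105), (13, 16, 256, 105),
     (7, 128, 512, 105), (13, 16, 128, 106), (13, 128, 256, 122), (86, 4, 32, 128),
     (7, 32, 256, 128), (20, 32, 512, 130), (40, 64, 256, 132), (6, 32, 1024, 133),
     (7, 32, 64, 136), (27, 32, 2048, 136), (6, 8, 1024, 145), (160, 8, 32, 151),
     (6, 64, 1024, 151), (14, 64, 2048, 151), (20, 1, 444, 152), (7, 1, 700, 152),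
     (100, 32, 64, 158), (20, 8, 512, 162), (40, 1, 420, 164), (27, 2, 2048, 168),
     (20, 16, 64, 171), (67, 16, 256, 171), (60, 4, 256, 186), (27, 4, 2048, 186),
     (6, 2, 1024, 188), (13, 64, 2048, 190), (67, 1, 490, 194), (20, 1, 706, 194),
     (40, 8, 256, 196), (27, 8, 2048, 196), (13, 2, 256, 205), (108, 16, 32, 205),
     (46, 16, 512, 206), (34, 4, 32, 218), (6, 4, 16, 234), (7, 4, 256, 234), (20, 4, 512, 234),
     (108, 16, 256, 236), (20, 4, 256, 250), (7, 32, 64, 256), (33, 32, 128, 256),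
     (40, 16, 32, 258), (6, 32, 64, 264), (40, 1, 8, 288), (40, 2, 128, 289), (40, 4, 16, 291),
     (40, 16, 128, 295), (40, 1, 64, 296), (33, 2, 64, 317), (20, 2, 128, 317), (7, 8, 32, 320),
     (27, 2, 4, 328), (13, 16, 128, 328), (27, 4, 16, 330), (27, 32, 128, 332), (13, 2, 32, 344),
     (33, 32, 128, 350), (27, 1, 1, 364), (13, 1, 1, 376), (33, 128, 512, 380), (33, 1, 1, 382),
     (40, 4, 32, 384), (40, 2, 4, 417), (60, 4, 64, 427), (7, 16, 64, 427), (60, 16, 64, 430),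
     (60, 1, 1, 442), (20, 2, 512, 444), (13, 4, 16, 456), (13, 2, 16, 461), (74, 4, 512, 490),
     (81, 2, 16, 492), (60, 1, 1, 494), (148, 16, 512, 494), (7, 1, 1, 506), (6, 2, 512, 508),
     (20, 64, 128, 512), (20, 16, 64, 516), (13, 2, 16, 552), (7, 16, 128, 552), (13, 64, 128, 554),
     (13, 2, 4, 568), (7, 4, 128, 568), (7, 2, 128, 573), (20, 1, 8, 576), (20, 2, 4, 577),
     (20, 4, 128, 579), (20, 2, 16, 581), (20, 16, 128, 583), (20, 1, 32, 584), (13, 1, 1, 618),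
     (20, 2, 64, 640), (7, 2, 64, 680), (46, 16, 32, 718), (7, 1, 1, 744), (26, 16, 256, 750),
     (53, 128, 1024, 790), (33, 128, 1024, 892), (60, 64, 2048, 926), (20, 2, 64, 956),
     (74, 1, 1, 1002), (100, 1, 1, 1006), (26, 2, 1024, 1020), (6, 32, 64, 1028), (6, 2, 128, 1048),
     (6, 64, 128, 1050), (6, 16, 128, 1060), (6, 8, 128, 1076), (6, 2, 32, 1092), (6, 8, 32, 1095),
     (6, 32, 128, 1102), (6, 1, 1, 1134), (6, 1, 1156, 1152), (6, 1, 1168, 1152),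
     (6, 1, 1174, 1152), (6, 1, 1242, 1152), (6, 1, 1262, 1152), (6, 1, 1278, 1152),
     (74, 1, 2026, 1152), (100, 1, 2030, 1152), (308, 1, 4094, 1152), (6, 32, 64, 1174),
     (6, 1, 1, 1176), (6, 1, 1, 1188), (6, 8, 64, 1206), (6, 1, 1, 1230), (6, 1, 1, 1238),
     (53, 64, 128, 1814), (53, 32, 128, 1878), (53, 8, 128, 1910), (33, 2, 128, 1916),
     (86, 1, 1, 1918), (74, 4, 2048, 2026), (174, 16, 2048, 2030), (26, 1, 1, 2044),
     (62, 1, 1, 2046), (27, 2, 16, 2048), (27, 4, 32, 2050), (27, 32, 64, 2054),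
     (27, 1, 2066, 2064), (27, 1, 2072, 2064), (27, 1, 2166, 2064), (14, 1, 2198, 2064),
     (27, 1, 2268, 2064), (27, 1, 2302, 2064), (27, 8, 16, 2082), (27, 16, 128, 2090),
     (27, 1, 1, 2098), (27, 16, 64, 2184), (14, 32, 64, 2198), (27, 1, 1, 2200), (14, 8, 64, 2230),
     (27, 4, 16, 2248), (14, 1, 1, 2262), (60, 32, 64, 2974), (60, 64, 1024, 3006),
     (86, 128, 128, 3967), (60, 1, 1, 4030), (60, 64, 64, 4031), (200, 32, 32, 4063),
     (74, 4, 16, 4074), (174, 1, 1, 4078), (174, 16, 16, 4079), (74, 1, 1, 4090), (74, 4, 4, 4091),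
     (26, 2, 2, 4093)]

theorem le_informationRatio_accessFHat : ((23 / 20 : ℝ) : EReal) ≤ accessFHat.informationRatio := by
  rw [accessFHat_eq]
  exact certificateFHat.le_informationRatio (by decide) rfl (by decide)
    (by decide +kernel) (by change (23 / 20 : ℝ) * (620 : ℕ) ≤ (713 : ℕ); norm_num) (by decide)

/-- The bit masks of the minimal accepted coalitions of `𝒬`. -/
def minsQ : List ℕ := [14, 50, 194, 84, 164, 152, 150, 102, 106, 108, 120, 232]

theorem accessQ_eq : accessQ = .generatedBy ((minsQ.map (maskSet 7)).toFinset) := by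
  unfold accessQ
  congr 1

/-- A certificate for the lower bound `17/15` on the information ratio of `𝒬`. -/
def certificateQ : Certificate where
  -- The secret merged with 7 is copied over the forbidden `1346`, then the pair 3, 4 over indices
  -- 0, 1, 6, 7, 8.
  steps := [⟨9, 451, [24]⟩, ⟨8, 90, [129]⟩]
  weights := [0, 2, 1, 1, 0, 0, 11]
  total := 17
  rows := [(3, 2, 128, 0), (2, 4, 32, 0), (1, 8, 16, 0), (3, 128, 256, 0), (6, 128, 512, 0),
     (3, 64, 128, 2), (1, 1, 334, 14), (2, 32, 256, 24), (2, 128, 256, 24), (2, 4, 128, 32),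
     (2, 4, 256, 56), (2, 2, 128, 61), (2, 64, 128, 62), (1, 4, 8, 66), (1, 32, 256, 66),
     (1, 32, 512, 66), (1, 8, 16, 71), (1, 16, 256, 75), (1, 8, 32, 86), (8, 4, 128, 91),
     (9, 32, 128, 94), (1, 4, 16, 99), (1, 8, 256, 99), (1, 1, 870, 102), (1, 256, 512, 102),
     (1, 1, 874, 106), (1, 16, 256, 106), (1, 8, 128, 114), (1, 4, 128, 122), (2, 1, 408, 152),
     (1, 4, 256, 161), (1, 4, 512, 161), (2, 64, 256, 188), (3, 1, 450, 194), (1, 1, 458, 194),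
     (1, 4, 8, 242), (1, 8, 256, 246), (2, 2, 256, 252), (1, 32, 128, 256), (3, 64, 128, 256),
     (1, 32, 512, 280), (1, 2, 4, 288), (1, 4, 64, 290), (1, 8, 128, 292), (1, 16, 128, 300),
     (1, 4, 512, 312), (3, 2, 128, 320), (1, 8, 512, 322), (1, 16, 512, 330), (1, 4, 128, 331),
     (1, 16, 128, 334), (1, 128, 512, 355), (1, 1, 1, 362), (11, 128, 512, 382), (1, 1, 32, 384),
     (1, 16, 512, 385), (1, 8, 512, 401), (1, 1, 1, 420), (1, 64, 512, 444), (1, 16, 32, 458),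
     (1, 1, 1, 462), (1, 4, 16, 490), (1, 1, 1, 494), (1, 1, 1, 502), (1, 2, 512, 508),
     (1, 32, 128, 512), (1, 4, 64, 544), (1, 16, 128, 548), (1, 128, 256, 564), (1, 2, 4, 608),
     (1, 1, 672, 640), (1, 1, 986, 640), (13, 1, 1022, 640), (1, 1, 1, 676), (1, 2, 128, 792),
     (1, 64, 128, 794), (1, 8, 128, 820), (1, 4, 8, 867), (1, 4, 16, 874), (1, 1, 1, 878),
     (1, 4, 128, 890), (11, 1, 1, 894), (11, 128, 128, 895), (1, 1, 1, 920), (1, 16, 16, 1007),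
     (1, 8, 8, 1015), (1, 1, 1, 1018), (2, 4, 4, 1019)]

theorem le_informationRatio_accessQ : ((17 / 15 : ℝ) : EReal) ≤ accessQ.informationRatio := by
  rw [accessQ_eq]
  exact certificateQ.le_informationRatio (by decide) rfl (by decide)
    (by decide +kernel) (by change (17 / 15 : ℝ) * (15 : ℕ) ≤ (17 : ℕ); norm_num) (by decide)

/-- The bit masks of the minimal accepted coalitions of `𝒬*`. -/
def minsQStar : List ℕ := [14, 50, 194, 84, 164, 150, 154, 106, 156, 108, 120, 184, 216, 232]

theorem accessQStar_eq : accessQStar = .generatedBy ((minsQStar.map (maskSet 7)).toFinset) := by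
  unfold accessQStar
  congr 1

/-- A certificate for the lower bound `8/7` on the information ratio of `𝒬*`. -/
def certificateQStar : Certificate where
  -- The secret merged with 7 is copied over the forbidden `1256`, then the pair 2, 6 over indices
  -- 0, 1, 4, 5.
  steps := [⟨9, 51, [68]⟩, ⟨8, 102, [129]⟩]
  weights := [2, 2, 0, 3, 2, 2, 3]
  total := 16
  rows := [(1, 2, 32, 0), (1, 2, 64, 0), (1, 4, 64, 0), (2, 4, 128, 0), (1, 4, 512, 0),
     (2, 8, 32, 0), (2, 16, 32, 0), (1, 16, 512, 0), (2, 64, 128, 0), (1, 128, 256, 0),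
     (1, 16, 512, 4), (1, 32, 128, 4), (1, 16, 32, 8), (1, 32, 128, 8), (1, 1, 318, 14),
     (1, 1, 350, 14), (1, 64, 512, 21), (1, 128, 256, 24), (3, 2, 16, 32), (1, 4, 512, 34),
     (1, 8, 512, 34), (1, 16, 256, 36), (1, 64, 512, 38), (1, 128, 512, 42), (1, 8, 128, 48),
     (1, 8, 256, 52), (1, 2, 512, 61), (2, 2, 128, 64), (1, 8, 256, 66), (1, 128, 512, 68),
     (1, 16, 256, 74), (1, 32, 256, 91), (2, 8, 16, 103), (2, 8, 128, 103), (1, 16, 128, 103),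
     (1, 16, 512, 103), (1, 16, 128, 110), (1, 4, 256, 122), (1, 4, 32, 128), (1, 16, 512, 136),
     (1, 4, 256, 153), (1, 32, 512, 153), (1, 64, 256, 156), (1, 8, 64, 160), (1, 1, 420, 164),
     (1, 1, 742, 164), (1, 16, 64, 171), (1, 2, 512, 177), (1, 4, 64, 178), (1, 64, 256, 182),
     (1, 1, 440, 184), (1, 1, 450, 194), (1, 1, 474, 194), (1, 8, 512, 196), (1, 16, 32, 205),
     (1, 32, 256, 220), (1, 32, 512, 220), (1, 2, 8, 225), (1, 2, 512, 236), (1, 4, 8, 242),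
     (1, 2, 256, 252), (1, 4, 128, 256), (1, 64, 128, 256), (1, 32, 128, 260), (1, 32, 64, 280),
     (1, 4, 64, 312), (1, 64, 128, 318), (1, 2, 128, 320), (1, 2, 4, 344), (1, 4, 128, 347),
     (1, 32, 512, 348), (1, 4, 128, 354), (3, 16, 512, 366), (1, 1, 1, 378), (1, 1, 16, 384),
     (1, 32, 64, 385), (1, 1, 8, 400), (1, 1, 1, 412), (1, 4, 8, 417), (1, 4, 16, 425),
     (1, 8, 64, 438), (1, 2, 4, 440), (1, 4, 64, 442), (1, 1, 1, 444), (2, 1, 1, 446),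
     (1, 2, 32, 449), (1, 4, 32, 474), (1, 1, 1, 478), (1, 1, 1, 482), (2, 1, 1, 506),
     (1, 1, 532, 528), (1, 1, 572, 528), (1, 1, 630, 528), (1, 1, 664, 528), (1, 1, 688, 528),
     (1, 1, 698, 528), (1, 1, 766, 528), (1, 1, 894, 528), (7, 1, 1022, 528), (1, 64, 256, 572),
     (1, 16, 32, 580), (1, 1, 1, 596), (1, 2, 16, 612), (1, 16, 128, 615), (1, 2, 256, 636),
     (1, 1, 1, 638), (1, 4, 32, 648), (1, 32, 64, 652), (1, 2, 16, 680), (1, 2, 64, 688),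
     (1, 1, 1, 690), (1, 1, 1, 696), (1, 32, 256, 732), (1, 8, 16, 742), (1, 2, 256, 752),
     (1, 1, 1, 758), (1, 2, 128, 828), (1, 1, 1, 830), (1, 2, 32, 860), (1, 32, 128, 862),
     (3, 16, 128, 878), (3, 128, 128, 895), (1, 2, 64, 956), (2, 64, 64, 959), (1, 2, 32, 988),
     (2, 1, 1, 990), (2, 32, 32, 991), (3, 1, 1, 1006), (3, 16, 16, 1007), (1, 2, 4, 1008),
     (1, 2, 8, 1012), (2, 4, 4, 1019), (2, 1, 1, 1020), (2, 2, 2, 1021)]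

theorem le_informationRatio_accessQStar : ((8 / 7 : ℝ) : EReal) ≤ accessQStar.informationRatio := by
  rw [accessQStar_eq]
  exact certificateQStar.le_informationRatio (by decide) rfl (by decide)
    (by decide +kernel) (by change (8 / 7 : ℝ) * (14 : ℕ) ≤ (16 : ℕ); norm_num) (by decide)

end SecretSharing

theorem mainTheorem2 :
    ((57 / 50 : ℝ) : EReal) ≤ SecretSharing.accessA.informationRatio ∧
    ((52 / 45 : ℝ) : EReal) ≤ SecretSharing.accessAStar.informationRatio ∧
    ((17 / 15 : ℝ) : EReal) ≤ SecretSharing.accessF.informationRatio ∧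
    ((8 / 7 : ℝ) : EReal) ≤ SecretSharing.accessFStar.informationRatio ∧
    ((23 / 20 : ℝ) : EReal) ≤ SecretSharing.accessFHat.informationRatio ∧
    ((17 / 15 : ℝ) : EReal) ≤ SecretSharing.accessQ.informationRatio ∧
    ((8 / 7 : ℝ) : EReal) ≤ SecretSharing.accessQStar.informationRatio :=
  ⟨SecretSharing.le_informationRatio_accessA,
    SecretSharing.le_informationRatio_accessAStar,
    SecretSharing.le_informationRatio_accessF,
    SecretSharing.le_informationRatio_accessFStar,
    SecretSharing.le_informationRatio_accessFHat,
    SecretSharing.le_informationRatio_accessQ,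
    SecretSharing.le_informationRatio_accessQStar⟩
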